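/- A permutation of length $n$ is $\pi=\pi_1\cdots\pi_n\in S_n$; $\pi$ is \emph{separable} if it avoids $2413$ and $3142$ (the empty permutation is separable). For $k\ge 1$, $P_k$ is the flat partially ordered pattern on the labels $1,\dots,k$ in which $k$ is larger than each of $1,\dots,k-1$ and there are no other relations; an occurrence of $P_k$ in $\pi$ is a subsequence of length $k$ whose last element is larger than its other $k-1$ elements. $S_n(2413,3142,P_k)$ is the set of separable permutations of length $n$ without an occurrence of $P_k$. Write $\mathrm{asc},\mathrm{des}$ for the numbers of ascents and descents, $\mathrm{lmax},\mathrm{rmax},\mathrm{lmin},\mathrm{rmin}$ for the numbers of left-to-right maxima, right-to-left maxima, left-to-right minima and right-to-left minima, and $$w(\pi)=p^{\mathrm{asc}(\pi)}q^{\mathrm{des}(\pi)}u^{\mathrm{lmax}(\pi)}v^{\mathrm{rmax}(\pi)}s^{\mathrm{lmin}(\pi)}t^{\mathrm{rmin}(\pi)}.$$ Let $X_n=X_n(p,q,u,v,s,t)=\sum_{\pi}w(\pi)$ over all separable permutations of length $n$, and let $$F_k=F_k(x,p,q,u,v,s,t)=\sum_{n\ge 0}x^n\sum_{\pi\in S_n(2413,3142,P_k)}w(\pi)\in\mathbb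 Z[p,q,u,v,s,t][[x]].$$ For $0\le i\le k-2$ let $f_{k,i}$ be the series $\sum_{n\ge1}x^n\sum_\pi w(\pi)$ over those $\pi\in S_n(2413,3142,P_k)$ with exactly $i$ elements to the left of $n$ and with $n-1$ (if it exists) to the right of $n$, and let $g_{k,i}$ be the series $\sum_{n\ge2}x^n\sum_\pi w(\pi)$ over those $\pi\in S_n(2413,3142,P_k)$ with exactly $i$ elements to the left of $n$ and with $n-1$ to the left of $n$. \textbf{Theorem.} For every $k\ge2$, the following system holds: $$F_k=1+\sum_{i=0}^{k-2}(f_{k,i}+g_{k,i}),$$ and for $1\le i\le k-2$ \begin{align*} f_{k,i}={}&pquvx^{i+1}X_i(p,q,u,1,s,t)\,(F_{k-i}(x,p,q,1,v,1,t)-1)\\ &+pq^2uvx^{i+1}X_i(p,q,u,1,s,1)\,(F_{k-i}(x,p,q,1,v,1,1)-1)(F_k(x,p,q,1,v,s,t)-1)\\ &+pq\,(F_{k-i}(x,p,q,1,v,1,1)-1)\sum_{j=1}^{i-1}X_j(p,q,u,1,1,1)\,x^jf_{k,i-j},\\ g_{k,i}={}&puvtx^{i+1}X_i(p,q,u,1,s,t)+pquvx^{i+1}X_i(p,q,u,1,s,1)\,(F_k(x,p,q,1,v,s,t)-1)\\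 &+p^2quvx^{i+1}\sum_{j=1}^{i-1}X_j(p,q,u,1,1,1)\,X_{i-j}(p,q,u,1,s,t)\,(F_{k-i+j}(x,p,q,1,v,1,t)-1)\\ &+pq\sum_{j=1}^{i-1}X_j(p,q,u,1,1,1)\,x^j\,(F_{k-i+j}(x,p,q,1,v,1,1)-1)\bigl(g_{k,i-j}-puvtx^{i-j+1}X_{i-j}(p,q,u,1,s,t)\bigr), \end{align*} with the initial conditions $$f_{k,0}=uvstx+quvsx\,(F_k(x,p,q,1,v,s,t)-1),\qquad g_{k,0}=0,\qquad f_{2,0}=\frac{uvstx}{1-qvsx}.$$ Moreover, the system determines $F_k$: if $\Phi_m,\varphi_{m,i},\gamma_{m,i}\in\mathbb Z[p,q,u,v,s,t][[x]]$ ($2\le m\le k$, $0\le i\le m-2$) satisfy all these equations for every $m$ with $2\le m\le k$ (with $\Phi,\varphi,\gamma,m$ in place of $F,f,g,k$ and the polynomials $X_j$ as above), then $\Phi_k=F_k$, and $\varphi_{k,i}=f_{k,i}$, $\gamma_{k,i}=g_{k,i}$ for all $0\le i\le k-2$. -/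

import Mathlib

namespace SepPOP

noncomputable section

/-! ### Permutations, patterns and statistics

A permutation of length `n` is `π : Equiv.Perm (Fin n)`; positions and values are counted from `0`,
so the largest element of `π` is the one with `(π a).val + 1 = n`. -/

/-- `π` contains the classical pattern whose one-line notation is `w`. -/
def ContainsPattern {m n : ℕ} (w : Fin m → ℕ) (π : Equiv.Perm (Fin n)) : Prop :=
  ∃ e : Fin m ↪o Fin n, ∀ i j, w i < w j ↔ π (e i) < π (e j)

/-- `π` contains the partially ordered pattern on the labels `0, …, m - 1` whose strict partial
order is `r`: some subsequence of length `m` respects every relation of the poset. -/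
def ContainsPOP {m n : ℕ} (r : Fin m → Fin m → Prop) (π : Equiv.Perm (Fin n)) : Prop :=
  ∃ e : Fin m ↪o Fin n, ∀ i j, r i j → π (e i) < π (e j)

/-- The strict order of the flat POP `P_k`: the last label is above all the others, and there are
no other relations. -/
def flatPOP (k : ℕ) : Fin k → Fin k → Prop := fun i j => i < j ∧ j.val + 1 = k

/-- Separable permutations: those that avoid `2413` and `3142`. -/
def Separable {n : ℕ} (π : Equiv.Perm (Fin n)) : Prop :=
  ¬ ContainsPattern ![2, 4, 1, 3] π ∧ ¬ ContainsPattern ![3, 1, 4, 2] π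

/-- Membership in `S_n(2413, 3142, P_k)`. -/
def SepAvoid (k : ℕ) {n : ℕ} (π : Equiv.Perm (Fin n)) : Prop :=
  Separable π ∧ ¬ ContainsPOP (flatPOP k) π

open Classical in
/-- Number of ascents. -/
def asc {n : ℕ} (π : Equiv.Perm (Fin n)) : ℕ :=
  (Finset.univ.filter fun i : Fin n => ∃ j : Fin n, j.val = i.val + 1 ∧ π i < π j).card

open Classical in
/-- Number of descents. -/
def des {n : ℕ} (π : Equiv.Perm (Fin n)) : ℕ :=
  (Finset.univ.filter fun i : Fin n => ∃ j : Fin n, j.val = i.val + 1 ∧ π j < π i).card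

open Classical in
/-- Number of left-to-right maxima. -/
def lmax {n : ℕ} (π : Equiv.Perm (Fin n)) : ℕ :=
  (Finset.univ.filter fun i : Fin n => ∀ j, j < i → π j < π i).card

open Classical in
/-- Number of right-to-left maxima. -/
def rmax {n : ℕ} (π : Equiv.Perm (Fin n)) : ℕ :=
  (Finset.univ.filter fun i : Fin n => ∀ j, i < j → π j < π i).card

open Classical in
/-- Number of left-to-right minima. -/
def lmin {n : ℕ} (π : Equiv.Perm (Fin n)) : ℕ :=
  (Finset.univ.filter fun i : Fin n => ∀ j, j < i → π i < π j).card

open Classical in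
/-- Number of right-to-left minima. -/
def rmin {n : ℕ} (π : Equiv.Perm (Fin n)) : ℕ :=
  (Finset.univ.filter fun i : Fin n => ∀ j, i < j → π i < π j).card

/-! ### Polynomials in `p, q, u, v, s, t` and power series in `x` over them -/

/-- `ℤ[p, q, u, v, s, t]`. -/
abbrev Poly := MvPolynomial (Fin 6) ℤ

/-- `ℤ[p, q, u, v, s, t]⟦x⟧`. -/
abbrev Series := PowerSeries Poly

def p : Poly := MvPolynomial.X 0
def q : Poly := MvPolynomial.X 1
def u : Poly := MvPolynomial.X 2
def v : Poly := MvPolynomial.X 3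
def s : Poly := MvPolynomial.X 4
def t : Poly := MvPolynomial.X 5

/-- The variable `x` of the power series. -/
def x : Series := PowerSeries.X

/-- A polynomial in `p, q, u, v, s, t` as a constant power series. -/
abbrev c (a : Poly) : Series := PowerSeries.C a

/-- `polyAt ![a₁, …, a₆] h` is `h(a₁, …, a₆)`, where the arguments are in the order
`p, q, u, v, s, t`. -/
def polyAt (a : Fin 6 → Poly) : Poly →ₐ[ℤ] Poly := MvPolynomial.aeval a

/-- `serAt ![a₁, …, a₆] G` is `G(x, a₁, …, a₆)`. -/
def serAt (a : Fin 6 → Poly) : Series →+* Series := PowerSeries.map (polyAt a).toRingHom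

/-! ### Generating functions -/

/-- The weight `p^asc q^des u^lmax v^rmax s^lmin t^rmin`. -/
def weight {n : ℕ} (π : Equiv.Perm (Fin n)) : Poly :=
  p ^ asc π * q ^ des π * u ^ lmax π * v ^ rmax π * s ^ lmin π * t ^ rmin π

open Classical in
/-- `F_k(x, p, q, u, v, s, t)`, over all `n ≥ 0` and all of `S_n(2413, 3142, P_k)`. -/
def genF (k : ℕ) : Series :=
  PowerSeries.mk fun n =>
    ∑ π ∈ Finset.univ.filter (fun π : Equiv.Perm (Fin n) => SepAvoid k π), weight π

/-- Exactly `i` elements stand to the left of the largest element (so the length is positive), and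
the second largest element, if it exists, stands to the right of the largest one. -/
def MaxThenSecond (i : ℕ) {n : ℕ} (π : Equiv.Perm (Fin n)) : Prop :=
  ∃ a : Fin n, (π a).val + 1 = n ∧ a.val = i ∧ ∀ b : Fin n, (π b).val + 2 = n → a < b

/-- Exactly `i` elements stand to the left of the largest element, and the second largest element
exists (so the length is at least `2`) and stands to the left of the largest one. -/
def SecondThenMax (i : ℕ) {n : ℕ} (π : Equiv.Perm (Fin n)) : Prop :=
  ∃ a : Fin n, (π a).val + 1 = n ∧ a.val = i ∧ ∃ b : Fin n, (π b).val + 2 = n ∧ b < a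

open Classical in
/-- `f_{k,i}(x, p, q, u, v, s, t)`. -/
def genf (k i : ℕ) : Series :=
  PowerSeries.mk fun n =>
    ∑ π ∈ Finset.univ.filter
      (fun π : Equiv.Perm (Fin n) => SepAvoid k π ∧ MaxThenSecond i π), weight π

open Classical in
/-- `g_{k,i}(x, p, q, u, v, s, t)`. -/
def geng (k i : ℕ) : Series :=
  PowerSeries.mk fun n =>
    ∑ π ∈ Finset.univ.filter
      (fun π : Equiv.Perm (Fin n) => SepAvoid k π ∧ SecondThenMax i π), weight π

open Classical in
/-- `X_n(p, q, u, v, s, t)`, over all separable permutations of length `n`. -/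
def X (n : ℕ) : Poly :=
  ∑ π ∈ Finset.univ.filter (fun π : Equiv.Perm (Fin n) => Separable π), weight π

/-! ### The system of functional equations -/

/-- The system at level `k`, for arbitrary families `F k` and `f k i`, `g k i` of power series. -/
structure IsSolution (k : ℕ) (F : ℕ → Series) (f g : ℕ → ℕ → Series) : Prop where
  eq_F : F k = 1 + ∑ i ∈ Finset.range (k - 1), (f k i + g k i)
  eq_f : ∀ i, 1 ≤ i → i ≤ k - 2 →
    f k i =
      c (p * q * u * v) * x ^ (i + 1) * c (polyAt ![p, q, u, 1, s, t] (X i))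
          * (serAt ![p, q, 1, v, 1, t] (F (k - i)) - 1)
      + c (p * q ^ 2 * u * v) * x ^ (i + 1) * c (polyAt ![p, q, u, 1, s, 1] (X i))
          * (serAt ![p, q, 1, v, 1, 1] (F (k - i)) - 1)
          * (serAt ![p, q, 1, v, s, t] (F k) - 1)
      + c (p * q) * (serAt ![p, q, 1, v, 1, 1] (F (k - i)) - 1)
          * ∑ j ∈ Finset.Icc 1 (i - 1),
              c (polyAt ![p, q, u, 1, 1, 1] (X j)) * x ^ j * f k (i - j)
  eq_g : ∀ i, 1 ≤ i → i ≤ k - 2 →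
    g k i =
      c (p * u * v * t) * x ^ (i + 1) * c (polyAt ![p, q, u, 1, s, t] (X i))
      + c (p * q * u * v) * x ^ (i + 1) * c (polyAt ![p, q, u, 1, s, 1] (X i))
          * (serAt ![p, q, 1, v, s, t] (F k) - 1)
      + c (p ^ 2 * q * u * v) * x ^ (i + 1)
          * ∑ j ∈ Finset.Icc 1 (i - 1),
              c (polyAt ![p, q, u, 1, 1, 1] (X j))
                * c (polyAt ![p, q, u, 1, s, t] (X (i - j)))
                * (serAt ![p, q, 1, v, 1, t] (F (k - i + j)) - 1)
      + c (p * q)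
          * ∑ j ∈ Finset.Icc 1 (i - 1),
              c (polyAt ![p, q, u, 1, 1, 1] (X j)) * x ^ j
                * (serAt ![p, q, 1, v, 1, 1] (F (k - i + j)) - 1)
                * (g k (i - j)
                    - c (p * u * v * t) * x ^ (i - j + 1)
                      * c (polyAt ![p, q, u, 1, s, t] (X (i - j))))
  init_f : f k 0 =
    c (u * v * s * t) * x + c (q * u * v * s) * x * (serAt ![p, q, 1, v, s, t] (F k) - 1)
  init_g : g k 0 = 0
  /-- `f_{2,0} = u v s t x / (1 - q v s x)`; the denominator is a unit of the power series ring. -/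
  init_f_two : k = 2 → f 2 0 * (1 - c (q * v * s) * x) = c (u * v * s * t) * x

end

end SepPOP

/-!
A permutation of length `m + 1` is coded by the pair `(L, R)` of words in `0, …, m - 1` to the left
and to the right of its largest entry `m`. In a separable permutation, avoidance of `2413` and
`3142` with `m` in the role of `4` makes `L` a direct sum and `R` a skew sum of blocks whose values
interleave. So the top block can be split off: if the second largest entry stands in `R`, the
entries of `R` above all of `L` come first in `R` and are the top values (`exists_insertRight_eq`);
if it stands in `L` and `R` is nonempty, the entries of `L` above all of `R` come last in `L` and
are the top values (`exists_insertLeft_eq`). No further standardization is needed, because the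
block, shifted down, and the remaining word are again permutations of initial segments
(`perm_range_split`).

Both removals are bijections (`gf_insertRight`, `gf_insertLeft`). Separability is a condition on
the two parts because `2413` and `3142` are simple (`sepWord_block`). The flat pattern of length `k`
is avoided iff the rest avoids it and, for a block in `R`, the block avoids the flat pattern of
length `k - i`, where `i` is the length of `L`: all of `L` lies below and to the left of the block.
The weight is multiplicative up to a monomial (`wt_insert_right`, `wt_insert_left`), with separate
formulas when `L` or `R` of the smaller permutation is empty. Removal on the right turns the class
counted by `f` into that counted by `g`, and removal on the left does the opposite, which gives the
two recurrences `genf_eq_add` and `gengInner_eq`. Substituting each into the other yields the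
system.

Uniqueness: once `F_m` is known for `m < k`, every occurrence of `F_k` on the right-hand sides is
multiplied by a power of `x`, so agreement of two solutions modulo `x ^ n` improves to agreement
modulo `x ^ (n + 1)` (`agree_F`).
-/

namespace SepPOP

/-! ### Statistics of words -/

/-- The number of indices at which two consecutive entries of `l` are related by `r`: ascents for
`<`, descents for `>`. -/
def steps (r : ℕ → ℕ → Prop) [DecidableRel r] : List ℕ → ℕ
  | [] => 0
  | [_] => 0
  | a :: b :: l => (if r a b then 1 else 0) + steps r (b :: l)

/-- The number of entries `a` of `l` such that `r b a` for all later entries `b`: right-to-left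
maxima for `<`, right-to-left minima for `>`. The left-to-right versions are obtained from the
reversed word. -/
def sufCount (r : ℕ → ℕ → Prop) [DecidableRel r] : List ℕ → ℕ
  | [] => 0
  | a :: l => (if ∀ b ∈ l, r b a then 1 else 0) + sufCount r l

section
variable (r : ℕ → ℕ → Prop) [DecidableRel r]

theorem steps_append_of_rel {A B : List ℕ} (h : ∀ a ∈ A, ∀ b ∈ B, r a b) (hA : A ≠ [])
    (hB : B ≠ []) : steps r (A ++ B) = steps r A + steps r B + 1 := by
  induction A with
  | nil => exact absurd rfl hA
  | cons a A ih =>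
    cases A with
    | nil =>
      cases B with
      | nil => exact absurd rfl hB
      | cons b B => simp [steps, h a (by simp) b (by simp)]; omega
    | cons a' A =>
      have := ih (fun x hx => h x (by simp [hx])) (by simp)
      simp only [List.cons_append, steps] at this ⊢
      omega

theorem steps_append_of_not_rel {A B : List ℕ} (h : ∀ a ∈ A, ∀ b ∈ B, ¬ r a b) :
    steps r (A ++ B) = steps r A + steps r B := by
  induction A with
  | nil => simp [steps]
  | cons a A ih =>
    cases A with
    | nil =>
      cases B with
      | nil => simp [steps]
      | cons b B => simp [steps, h a (by simp) b (by simp)]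
    | cons a' A =>
      have := ih (fun x hx => h x (by simp [hx]))
      simp only [List.cons_append, steps] at this ⊢
      omega

theorem steps_map {g : ℕ → ℕ} (hg : ∀ a b, r (g a) (g b) ↔ r a b) (l : List ℕ) :
    steps r (l.map g) = steps r l := by
  induction l with
  | nil => rfl
  | cons a l ih =>
    cases l with
    | nil => rfl
    | cons b l =>
      simp only [List.map_cons, steps, hg] at ih ⊢
      rw [ih]

theorem steps_append_cons (A B : List ℕ) (x : ℕ) :
    steps r (A ++ x :: B) = steps r (A ++ [x]) + steps r (x :: B) := by
  induction A with
  | nil => simp [steps]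
  | cons a A ih =>
    cases A with
    | nil => simp [steps]
    | cons a' A =>
      simp only [List.cons_append, steps] at ih ⊢
      omega

theorem sufCount_append_of_rel {A B : List ℕ} (h : ∀ a ∈ A, ∀ b ∈ B, r b a) :
    sufCount r (A ++ B) = sufCount r A + sufCount r B := by
  induction A with
  | nil => simp [sufCount]
  | cons a A ih =>
    have h1 : (∀ b ∈ A ++ B, r b a) ↔ ∀ b ∈ A, r b a :=
      ⟨fun H b hb => H b (by simp [hb]), fun H b hb => by
        rcases List.mem_append.1 hb with hb | hb
        · exact H b hb
        · exact h a (by simp) b hb⟩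
    rw [List.cons_append, sufCount, sufCount, ih fun x hx => h x (by simp [hx])]
    simp only [h1]
    omega

/-- A block `B` none of whose entries is counted, and which does not disturb the entries in front
of it, may be deleted. -/
theorem sufCount_remove {A B C : List ℕ} (hA : ∀ a ∈ A, ∀ b ∈ B, r b a)
    (hC : ∀ b ∈ B, ∃ c ∈ C, ¬ r c b) : sufCount r (A ++ (B ++ C)) = sufCount r (A ++ C) := by
  induction A with
  | nil =>
    clear hA
    induction B with
    | nil => rfl
    | cons b B ih =>
      have : ¬ ∀ x ∈ B ++ C, r x b := fun H => by
        obtain ⟨c, hc, hn⟩ := hC b (by simp)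
        exact hn (H c (by simp [hc]))
      have ih' := ih fun x hx => hC x (by simp [hx])
      simp only [List.nil_append, List.cons_append, sufCount, if_neg this] at ih' ⊢
      omega
  | cons a A ih =>
    have h1 : (∀ x ∈ A ++ (B ++ C), r x a) ↔ ∀ x ∈ A ++ C, r x a := by
      constructor
      · intro H x hx
        apply H
        simp only [List.mem_append] at hx ⊢
        tauto
      · intro H x hx
        simp only [List.mem_append] at hx H
        rcases hx with hx | hx | hx
        · exact H x (.inl hx)
        · exact hA a (by simp) x hx
        · exact H x (.inr hx)
    rw [List.cons_append, List.cons_append, sufCount, sufCount, ih fun x hx => hA x (by simp [hx])]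
    simp only [h1]

theorem sufCount_append_of_not_rel {B C : List ℕ} (hC : ∀ b ∈ B, ∃ c ∈ C, ¬ r c b) :
    sufCount r (B ++ C) = sufCount r C :=
  sufCount_remove (A := []) r (by simp) hC

theorem sufCount_map {g : ℕ → ℕ} (hg : ∀ a b, r (g a) (g b) ↔ r a b) (l : List ℕ) :
    sufCount r (l.map g) = sufCount r l := by
  induction l with
  | nil => rfl
  | cons a l ih => simp [sufCount, hg, ih]

end

/-- The weight of a word, with the variables `p, q, u, v, s, t` replaced by `a 0, …, a 5`. -/
noncomputable def wt (a : Fin 6 → Poly) (l : List ℕ) : Poly :=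
  a 0 ^ steps (· < ·) l * a 1 ^ steps (· > ·) l * a 2 ^ sufCount (· < ·) l.reverse *
    a 3 ^ sufCount (· < ·) l * a 4 ^ sufCount (· > ·) l.reverse * a 5 ^ sufCount (· > ·) l

theorem wt_map_add (a : Fin 6 → Poly) (m : ℕ) (l : List ℕ) : wt a (l.map (· + m)) = wt a l := by
  have h1 : ∀ a b : ℕ, a + m < b + m ↔ a < b := by intros; omega
  have h2 : ∀ a b : ℕ, a + m > b + m ↔ a > b := by intros; omega
  simp only [wt, ← List.map_reverse, steps_map _ h1, steps_map _ h2, sufCount_map _ h1,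
    sufCount_map _ h2]

/-! ### The weight of `L m R` with `m` above `L` and `R` -/

section
variable {L R S : List ℕ} {m N : ℕ}

theorem steps_lt_word (hL : ∀ a ∈ L, a < m) (hR : ∀ a ∈ R, a < m) :
    steps (· < ·) (L ++ m :: R) = steps (· < ·) L + steps (· < ·) R + if L = [] then 0 else 1 := by
  have h1 : steps (· < ·) ([m] ++ R) = steps (· < ·) [m] + steps (· < ·) R :=
    steps_append_of_not_rel _ (by simpa using fun a ha => (hR a ha).le)
  rw [List.singleton_append] at h1
  rw [steps_append_cons, h1]
  split_ifs with h0
  · subst h0; simp [steps]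
  · rw [steps_append_of_rel _ (by simpa using hL) h0 (by simp)]
    simp only [steps]; omega

theorem steps_gt_word (hL : ∀ a ∈ L, a < m) (hR : ∀ a ∈ R, a < m) :
    steps (· > ·) (L ++ m :: R) = steps (· > ·) L + steps (· > ·) R + if R = [] then 0 else 1 := by
  have h1 : steps (· > ·) (L ++ [m]) = steps (· > ·) L + steps (· > ·) [m] :=
    steps_append_of_not_rel _ (by simpa using fun a ha => (hL a ha).le)
  rw [steps_append_cons, h1]
  split_ifs with h0
  · subst h0; simp [steps]
  · have h2 : steps (· > ·) ([m] ++ R) = steps (· > ·) [m] + steps (· > ·) R + 1 :=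
      steps_append_of_rel _ (by simpa using hR) (by simp) h0
    rw [List.singleton_append] at h2
    rw [h2]
    simp only [steps]; omega

theorem lmax_word (hL : ∀ a ∈ L, a < m) (hR : ∀ a ∈ R, a < m) :
    sufCount (· < ·) (L ++ m :: R).reverse = sufCount (· < ·) L.reverse + 1 := by
  rw [List.reverse_append, List.reverse_cons, List.append_assoc, sufCount_append_of_not_rel]
  · simp only [List.singleton_append, sufCount, List.mem_reverse]
    rw [if_pos hL]; omega
  · intro b hb
    exact ⟨m, by simp, by simpa using (hR b (by simpa using hb)).le⟩

theorem rmax_word (hL : ∀ a ∈ L, a < m) (hR : ∀ a ∈ R, a < m) :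
    sufCount (· < ·) (L ++ m :: R) = sufCount (· < ·) R + 1 := by
  rw [sufCount_append_of_not_rel]
  · simp only [sufCount]
    rw [if_pos hR]; omega
  · intro b hb
    exact ⟨m, by simp, by simpa using (hL b hb).le⟩

theorem lmin_word_nil (hR : ∀ a ∈ R, a < m) :
    sufCount (· > ·) (m :: R).reverse = sufCount (· > ·) R.reverse + 1 := by
  rw [List.reverse_cons, sufCount_append_of_rel]
  · simp [sufCount]
  · simpa using hR

theorem lmin_word (hL : ∀ a ∈ L, a < m) (hR : ∀ a ∈ R, a < m) (h0 : L ≠ []) :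
    sufCount (· > ·) (L ++ m :: R).reverse = sufCount (· > ·) (L ++ R).reverse := by
  rw [List.reverse_append, List.reverse_cons, List.append_assoc, sufCount_remove,
    List.reverse_append]
  · simpa using hR
  · obtain ⟨c, hc⟩ := List.exists_mem_of_ne_nil L h0
    simpa using ⟨c, hc, (hL c hc).le⟩

theorem rmin_word_nil (hL : ∀ a ∈ L, a < m) :
    sufCount (· > ·) (L ++ [m]) = sufCount (· > ·) L + 1 := by
  rw [sufCount_append_of_rel]
  · simp [sufCount]
  · simpa using hL

theorem rmin_word (hL : ∀ a ∈ L, a < m) (hR : ∀ a ∈ R, a < m) (h0 : R ≠ []) :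
    sufCount (· > ·) (L ++ m :: R) = sufCount (· > ·) (L ++ R) := by
  rw [← List.singleton_append, sufCount_remove]
  · simpa using hL
  · obtain ⟨c, hc⟩ := List.exists_mem_of_ne_nil R h0
    simpa using ⟨c, hc, (hR c hc).le⟩

theorem wt_single (a : Fin 6 → Poly) (m : ℕ) : wt a [m] = a 2 * a 3 * a 4 * a 5 := by
  simp [wt, steps, sufCount]

/-- The largest entry comes first. -/
theorem wt_max_first (hR : ∀ a ∈ R, a < m) (h0 : R ≠ []) :
    wt ![p, q, u, v, s, t] (m :: R) = q * u * v * s * wt ![p, q, 1, v, s, t] R := by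
  have h1 := steps_lt_word (L := []) (by simp) hR
  have h2 := steps_gt_word (L := []) (by simp) hR
  have h3 := lmax_word (L := []) (by simp) hR
  have h4 := rmax_word (L := []) (by simp) hR
  have h5 := lmin_word_nil hR
  have h6 := rmin_word (L := []) (by simp) hR h0
  simp only [List.nil_append, h0, if_true, if_false] at h1 h2 h3 h4 h6
  rw [wt, wt, h1, h2, h3, h4, h5, h6]
  simp [steps, sufCount]
  ring

/-- The largest entry comes last. -/
theorem wt_max_last (hL : ∀ a ∈ L, a < m) (h0 : L ≠ []) :
    wt ![p, q, u, v, s, t] (L ++ [m]) = p * u * v * t * wt ![p, q, u, 1, s, t] L := by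
  have h5 := lmin_word (R := []) hL (by simp) h0
  rw [wt, wt, steps_lt_word hL (by simp), steps_gt_word hL (by simp), lmax_word hL (by simp),
    rmax_word hL (by simp), h5, rmin_word_nil hL]
  simp [steps, sufCount, h0]
  ring

/-- The word `L N S` with `L` below `S` and the largest entry `N` in between. -/
theorem wt_left_below (hLN : ∀ a ∈ L, a < N) (hSN : ∀ a ∈ S, a < N)
    (hLS : ∀ a ∈ L, ∀ b ∈ S, a < b) (hL : L ≠ []) (hS : S ≠ []) :
    wt ![p, q, u, v, s, t] (L ++ N :: S) =
      p * q * u * v * wt ![p, q, u, 1, s, t] L * wt ![p, q, 1, v, 1, t] S := by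
  obtain ⟨c, hc⟩ := List.exists_mem_of_ne_nil L hL
  have h5 : sufCount (· > ·) (L ++ S).reverse = sufCount (· > ·) L.reverse := by
    rw [List.reverse_append, sufCount_append_of_not_rel]
    simpa using fun b hb => ⟨c, hc, (hLS c hc b hb).le⟩
  have h6 : sufCount (· > ·) (L ++ S) = sufCount (· > ·) L + sufCount (· > ·) S :=
    sufCount_append_of_rel _ hLS
  rw [wt, wt, wt, steps_lt_word hLN hSN, steps_gt_word hLN hSN, lmax_word hLN hSN,
    rmax_word hLN hSN, lmin_word hLN hSN hL, rmin_word hLN hSN hS, h5, h6]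
  simp [hL, hS]
  ring

/-- The word `S N R` with `S` above `R` and the largest entry `N` in between. -/
theorem wt_left_above (hSN : ∀ a ∈ S, a < N) (hRN : ∀ a ∈ R, a < N)
    (hRS : ∀ a ∈ R, ∀ b ∈ S, a < b) (hR : R ≠ []) (hS : S ≠ []) :
    wt ![p, q, u, v, s, t] (S ++ N :: R) =
      p * q * u * v * wt ![p, q, u, 1, s, 1] S * wt ![p, q, 1, v, s, t] R := by
  obtain ⟨c, hc⟩ := List.exists_mem_of_ne_nil R hR
  have h5 : sufCount (· > ·) (S ++ R).reverse =
      sufCount (· > ·) R.reverse + sufCount (· > ·) S.reverse := by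
    rw [List.reverse_append, sufCount_append_of_rel]
    simpa using hRS
  have h6 : sufCount (· > ·) (S ++ R) = sufCount (· > ·) R := by
    rw [sufCount_append_of_not_rel]
    simpa using fun b hb => ⟨c, hc, (hRS c hc b hb).le⟩
  rw [wt, wt, wt, steps_lt_word hSN hRN, steps_gt_word hSN hRN, lmax_word hSN hRN,
    rmax_word hSN hRN, lmin_word hSN hRN hS, rmin_word hSN hRN hR, h5, h6]
  simp [hR, hS]
  ring

/-- A block `S` of values just below the largest entry is inserted immediately after it. -/
theorem wt_insert_right (hL : ∀ a ∈ L, a < m) (hR : ∀ a ∈ R, a < m) (hS : ∀ a ∈ S, m ≤ a)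
    (hSN : ∀ a ∈ S, a < N) (hmN : m ≤ N) (hL0 : L ≠ []) (hR0 : R ≠ []) (hS0 : S ≠ []) :
    wt ![p, q, u, v, s, t] (L ++ N :: (S ++ R)) =
      q * wt ![p, q, 1, v, 1, 1] S * wt ![p, q, u, v, s, t] (L ++ m :: R) := by
  have hLN : ∀ a ∈ L, a < N := fun a ha => (hL a ha).trans_le hmN
  have hRN : ∀ a ∈ S ++ R, a < N := fun a ha => (List.mem_append.1 ha).elim (hSN a)
    fun h => (hR a h).trans_le hmN
  have hRS : ∀ b ∈ S, ∀ a ∈ R, a < b := fun b hb a ha => (hR a ha).trans_le (hS b hb)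
  have hSR0 : S ++ R ≠ [] := by simp [hS0]
  obtain ⟨c, hc⟩ := List.exists_mem_of_ne_nil L hL0
  obtain ⟨d, hd⟩ := List.exists_mem_of_ne_nil R hR0
  have h1 : steps (· < ·) (S ++ R) = steps (· < ·) S + steps (· < ·) R :=
    steps_append_of_not_rel _ fun b hb a ha => (hRS b hb a ha).le.not_gt
  have h2 : steps (· > ·) (S ++ R) = steps (· > ·) S + steps (· > ·) R + 1 :=
    steps_append_of_rel _ hRS hS0 hR0
  have h4 : sufCount (· < ·) (S ++ R) = sufCount (· < ·) S + sufCount (· < ·) R :=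
    sufCount_append_of_rel _ hRS
  have h5 : sufCount (· > ·) (L ++ (S ++ R)).reverse = sufCount (· > ·) (L ++ R).reverse := by
    rw [List.reverse_append, List.reverse_append, List.append_assoc, sufCount_remove,
      List.reverse_append]
    · simpa using fun a ha b hb => hRS b hb a ha
    · simpa using fun b hb => ⟨c, hc, (hL c hc).le.trans (hS b hb)⟩
  have h6 : sufCount (· > ·) (L ++ (S ++ R)) = sufCount (· > ·) (L ++ R) := by
    rw [sufCount_remove]
    · exact fun a ha b hb => (hL a ha).trans_le (hS b hb)
    · exact fun b hb => ⟨d, hd, (hRS b hb d hd).le.not_gt⟩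
  rw [wt, wt, wt, steps_lt_word hLN hRN, steps_gt_word hLN hRN, lmax_word hLN hRN,
    rmax_word hLN hRN, lmin_word hLN hRN hL0, rmin_word hLN hRN hSR0, h1, h2, h4, h5, h6,
    steps_lt_word hL hR, steps_gt_word hL hR, lmax_word hL hR, rmax_word hL hR,
    lmin_word hL hR hL0, rmin_word hL hR hR0]
  simp [hL0, hR0, hS0]
  ring

/-- A block `S` of values just below the largest entry is inserted immediately before it. -/
theorem wt_insert_left (hL : ∀ a ∈ L, a < m) (hR : ∀ a ∈ R, a < m) (hS : ∀ a ∈ S, m ≤ a)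
    (hSN : ∀ a ∈ S, a < N) (hmN : m ≤ N) (hL0 : L ≠ []) (hR0 : R ≠ []) (hS0 : S ≠ []) :
    wt ![p, q, u, v, s, t] ((L ++ S) ++ N :: R) =
      p * wt ![p, q, u, 1, 1, 1] S * wt ![p, q, u, v, s, t] (L ++ m :: R) := by
  have hRN : ∀ a ∈ R, a < N := fun a ha => (hR a ha).trans_le hmN
  have hLN : ∀ a ∈ L ++ S, a < N := fun a ha => (List.mem_append.1 ha).elim
    (fun h => (hL a h).trans_le hmN) (hSN a)
  have hRS : ∀ b ∈ S, ∀ a ∈ R, a < b := fun b hb a ha => (hR a ha).trans_le (hS b hb)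
  have hLS : ∀ a ∈ L, ∀ b ∈ S, a < b := fun a ha b hb => (hL a ha).trans_le (hS b hb)
  have hSR0 : L ++ S ≠ [] := by simp [hS0]
  obtain ⟨c, hc⟩ := List.exists_mem_of_ne_nil L hL0
  obtain ⟨d, hd⟩ := List.exists_mem_of_ne_nil R hR0
  have h1 : steps (· < ·) (L ++ S) = steps (· < ·) L + steps (· < ·) S + 1 :=
    steps_append_of_rel _ hLS hL0 hS0
  have h2 : steps (· > ·) (L ++ S) = steps (· > ·) L + steps (· > ·) S :=
    steps_append_of_not_rel _ fun a ha b hb => (hLS a ha b hb).le.not_gt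
  have h4 : sufCount (· < ·) (L ++ S).reverse =
      sufCount (· < ·) S.reverse + sufCount (· < ·) L.reverse := by
    rw [List.reverse_append, sufCount_append_of_rel]
    simpa using fun b hb a ha => hLS a ha b hb
  have h5 : sufCount (· > ·) (L ++ S ++ R).reverse = sufCount (· > ·) (L ++ R).reverse := by
    rw [List.reverse_append, List.reverse_append, sufCount_remove, List.reverse_append]
    · simpa using fun a ha b hb => hRS b hb a ha
    · simpa using fun b hb => ⟨c, hc, (hLS c hc b hb).le⟩
  have h6 : sufCount (· > ·) (L ++ S ++ R) = sufCount (· > ·) (L ++ R) := by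
    rw [List.append_assoc, sufCount_remove]
    · exact hLS
    · exact fun b hb => ⟨d, hd, (hRS b hb d hd).le.not_gt⟩
  rw [wt, wt, wt, steps_lt_word hLN hRN, steps_gt_word hLN hRN, lmax_word hLN hRN,
    rmax_word hLN hRN, lmin_word hLN hRN hSR0, rmin_word hLN hRN hR0, h1, h2, h4, h5, h6,
    steps_lt_word hL hR, steps_gt_word hL hR, lmax_word hL hR, rmax_word hL hR,
    lmin_word hL hR hL0, rmin_word hL hR hR0]
  simp [hL0, hR0, hS0]
  ring

end

/-! ### Separability and avoidance of flat patterns for words -/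

/-- The four letters `a b c d` form an occurrence of `2413` or of `3142`. -/
def BadQuad (a b c d : ℕ) : Prop :=
  (c < a ∧ a < d ∧ d < b) ∨ (b < d ∧ d < a ∧ a < c)

/-- A word that avoids `2413` and `3142`. -/
def SepWord (l : List ℕ) : Prop :=
  ∀ a b c d, [a, b, c, d].Sublist l → ¬ BadQuad a b c d

theorem SepWord.sublist {l l' : List ℕ} (h : SepWord l) (hl : l'.Sublist l) : SepWord l' :=
  fun a b c d hs => h a b c d (hs.trans hl)

theorem quad_sublist_append {a b c d : ℕ} {A B C : List ℕ}
    (h : [a, b, c, d].Sublist (A ++ (B ++ C))) :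
    ∃ x y z : List ℕ, [a, b, c, d] = x ++ (y ++ z) ∧ x.Sublist A ∧ y.Sublist B ∧ z.Sublist C := by
  obtain ⟨x, w, h1, h2, h3⟩ := List.sublist_append_iff.1 h
  obtain ⟨y, z, h4, h5, h6⟩ := List.sublist_append_iff.1 h3
  exact ⟨x, y, z, by rw [h1, h4], h2, h5, h6⟩

/-- Replacing a letter that is larger than all the others by another such letter preserves
occurrences. -/
theorem badQuad_replace {x z : List ℕ} {m e e' a b c d : ℕ} (hx : ∀ a ∈ x, a < m)
    (hz : ∀ a ∈ z, a < m) (he : m ≤ e) (he' : m ≤ e') (h : [a, b, c, d] = x ++ ([e] ++ z))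
    (hbad : BadQuad a b c d) :
    ∃ a' b' c' d', [a', b', c', d'] = x ++ ([e'] ++ z) ∧ BadQuad a' b' c' d' := by
  rcases x with _ | ⟨x1, _ | ⟨x2, _ | ⟨x3, _ | ⟨x4, x⟩⟩⟩⟩ <;> simp at h
  · obtain ⟨rfl, rfl⟩ := h
    refine ⟨e', b, c, d, by simp, ?_⟩
    simp at hz
    unfold BadQuad at hbad ⊢; omega
  · obtain ⟨rfl, rfl, rfl⟩ := h
    refine ⟨a, e', c, d, by simp, ?_⟩
    simp at hx hz
    unfold BadQuad at hbad ⊢; omega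
  · obtain ⟨rfl, rfl, rfl, rfl⟩ := h
    refine ⟨a, b, e', d, by simp, ?_⟩
    simp at hx hz
    unfold BadQuad at hbad ⊢; omega
  · obtain ⟨rfl, rfl, rfl, rfl, rfl⟩ := h
    refine ⟨a, b, c, e', by simp, ?_⟩
    simp at hx
    unfold BadQuad at hbad ⊢; omega

/-- Neither pattern has an interval of two or three letters consisting of its largest values. -/
theorem badQuad_block {x y z : List ℕ} {m a b c d : ℕ} (hx : ∀ a ∈ x, a < m)
    (hy : ∀ a ∈ y, m ≤ a) (hz : ∀ a ∈ z, a < m) (h : [a, b, c, d] = x ++ (y ++ z))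
    (hbad : BadQuad a b c d) : y = [] ∨ (∃ e, y = [e]) ∨ y = [a, b, c, d] := by
  rcases y with _ | ⟨y1, _ | ⟨y2, y⟩⟩
  · exact .inl rfl
  · exact .inr (.inl ⟨y1, rfl⟩)
  · refine .inr (.inr ?_)
    unfold BadQuad at hbad
    rcases x with _ | ⟨x1, _ | ⟨x2, _ | ⟨x3, _ | ⟨x4, x⟩⟩⟩⟩ <;>
      rcases y with _ | ⟨y3, _ | ⟨y4, _ | ⟨y5, y⟩⟩⟩ <;> simp at h
    · obtain ⟨rfl, rfl, rfl⟩ := h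
      simp at hy hz; omega
    · obtain ⟨rfl, rfl, rfl, rfl⟩ := h
      simp at hy hz; omega
    · simp [h]
    · obtain ⟨rfl, rfl, rfl, rfl⟩ := h
      simp at hx hy hz; omega
    · obtain ⟨rfl, rfl, rfl, rfl, rfl⟩ := h
      simp at hx hy; omega
    · obtain ⟨rfl, rfl, rfl, rfl, rfl⟩ := h
      simp at hx hy; omega

/-- Both patterns are simple permutations, so an occurrence meets a block of top values in all four
letters, or in at most one. -/
theorem sepWord_block {A B C : List ℕ} {m : ℕ} (hA : ∀ a ∈ A, a < m) (hB : ∀ a ∈ B, m ≤ a)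
    (hC : ∀ a ∈ C, a < m) (hB0 : B ≠ []) :
    SepWord (A ++ (B ++ C)) ↔ SepWord B ∧ SepWord (A ++ ([m] ++ C)) := by
  obtain ⟨e, he⟩ := List.exists_mem_of_ne_nil B hB0
  have hme := hB e he
  constructor
  · refine fun h => ⟨h.sublist ?_, ?_⟩
    · exact (List.sublist_append_left B C).trans (List.sublist_append_right A _)
    · intro a b c d hs hbad
      obtain ⟨x, y, z, hxyz, hx, hy, hz⟩ := quad_sublist_append hs
      have hx' : ∀ a ∈ x, a < m := fun a ha => hA a (hx.subset ha)
      have hz' : ∀ a ∈ z, a < m := fun a ha => hC a (hz.subset ha)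
      have hsub : ∀ y' : List ℕ, y'.Sublist [e] → (x ++ (y' ++ z)).Sublist (A ++ (B ++ C)) :=
        fun y' hy' => hx.append ((hy'.trans (List.singleton_sublist.2 he)).append hz)
      rcases List.sublist_singleton.1 hy with rfl | rfl
      · exact h a b c d (hxyz ▸ hsub [] (by simp)) hbad
      · obtain ⟨a', b', c', d', h1, h2⟩ := badQuad_replace hx' hz' le_rfl hme hxyz hbad
        exact h a' b' c' d' (h1 ▸ hsub [e] (by simp)) h2
  · rintro ⟨h1, h2⟩ a b c d hs hbad
    obtain ⟨x, y, z, hxyz, hx, hy, hz⟩ := quad_sublist_append hs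
    have hx' : ∀ a ∈ x, a < m := fun a ha => hA a (hx.subset ha)
    have hy' : ∀ a ∈ y, m ≤ a := fun a ha => hB a (hy.subset ha)
    have hz' : ∀ a ∈ z, a < m := fun a ha => hC a (hz.subset ha)
    rcases badQuad_block hx' hy' hz' hxyz hbad with rfl | ⟨e, rfl⟩ | rfl
    · refine h2 a b c d ?_ hbad
      rw [hxyz]
      exact hx.append ((List.nil_sublist [m]).append hz)
    · obtain ⟨a', b', c', d', h3, h4⟩ :=
        badQuad_replace hx' hz' (hy' e (by simp)) le_rfl hxyz hbad
      refine h2 a' b' c' d' ?_ h4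
      rw [h3]
      exact hx.append ((List.Sublist.refl [m]).append hz)
    · exact h1 a b c d hy hbad

/-- `l` has no occurrence of the flat pattern of length `k` whose last letter lies in `l`, when `l`
is read after the word `P`: no letter of `l` has `k - 1` smaller letters in front of it, counting
those of `P`. -/
def AvoidFrom (k : ℕ) : List ℕ → List ℕ → Prop
  | _, [] => True
  | P, x :: l => P.countP (· < x) + 1 < k ∧ AvoidFrom k (P ++ [x]) l

theorem avoidFrom_append (k : ℕ) (P A B : List ℕ) :
    AvoidFrom k P (A ++ B) ↔ AvoidFrom k P A ∧ AvoidFrom k (P ++ A) B := by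
  induction A generalizing P with
  | nil => simp [AvoidFrom]
  | cons a A ih => simp [AvoidFrom, ih, and_assoc]

theorem avoidFrom_congr {k : ℕ} {P P' l : List ℕ}
    (h : ∀ x ∈ l, P.countP (· < x) = P'.countP (· < x)) :
    AvoidFrom k P l ↔ AvoidFrom k P' l := by
  induction l generalizing P P' with
  | nil => rfl
  | cons x l ih =>
    rw [AvoidFrom, AvoidFrom, h x (by simp), ih (P := P ++ [x]) (P' := P' ++ [x])]
    intro y hy
    rw [List.countP_append, List.countP_append, h y (by simp [hy])]

theorem avoidFrom_of_length {k : ℕ} {P l : List ℕ} (h : P.length + l.length < k) :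
    AvoidFrom k P l := by
  induction l generalizing P with
  | nil => trivial
  | cons x l ih =>
    simp only [List.length_cons] at h
    refine ⟨?_, ih (by simp; omega)⟩
    have := List.countP_le_length (p := (· < x)) (l := P)
    omega

/-- Letters below the whole block each use up one letter of the pattern. -/
theorem avoidFrom_shift {k m : ℕ} {P Q l : List ℕ} (hP : ∀ a ∈ P, a < m) :
    AvoidFrom k (P ++ Q.map (· + m)) (l.map (· + m)) ↔ AvoidFrom (k - P.length) Q l := by
  induction l generalizing Q with
  | nil => simp [AvoidFrom]
  | cons x l ih =>
    have h1 : P.countP (· < x + m) = P.length :=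
      List.countP_eq_length.2 fun a ha => by have := hP a ha; simp; omega
    have h2 : (Q.map (· + m)).countP (· < x + m) = Q.countP (· < x) := by
      rw [List.countP_map]; congr 1; ext a; simp
    have h3 := ih (Q := Q ++ [x])
    rw [List.map_append, ← List.append_assoc] at h3
    rw [List.map_cons, AvoidFrom, AvoidFrom, List.countP_append, h1, h2, ← h3]
    simp only [List.map_cons, List.map_nil]
    exact and_congr_left fun _ => by omega

/-- Words in the class `S(2413, 3142, P_k)`. -/
def AvSep (k : ℕ) (l : List ℕ) : Prop := SepWord l ∧ AvoidFrom k [] l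

section
variable {L R S : List ℕ} {m N k : ℕ}

theorem countP_lt_eq_length (hL : ∀ a ∈ L, a < m) : L.countP (· < m) = L.length :=
  List.countP_eq_length.2 fun a ha => by simpa using hL a ha

theorem countP_lt_eq_zero (hL : ∀ a ∈ L, m ≤ a) : L.countP (· < m) = 0 :=
  List.countP_eq_zero.2 fun a ha => by simpa using hL a ha

theorem avoidFrom_word_iff (hL : ∀ a ∈ L, a < m) (hR : ∀ a ∈ R, a < m) :
    AvoidFrom k [] (L ++ m :: R) ↔
      AvoidFrom k [] L ∧ L.length + 1 < k ∧ AvoidFrom k L R := by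
  rw [avoidFrom_append, AvoidFrom, List.nil_append, countP_lt_eq_length hL,
    avoidFrom_congr (P := L ++ [m]) (P' := L)]
  intro x hx
  have := (hR x hx).le
  simp [this]

theorem avoidFrom_of_length_lt (h : L.length + 1 < k) : AvoidFrom k [] L :=
  avoidFrom_of_length (by simp; omega)

theorem sepWord_singleton (m : ℕ) : SepWord [m] := fun a b c d h => by
  have := h.length_le
  simp at this

theorem sepWord_nil : SepWord [] := fun a b c d h => by
  have := h.length_le
  simp at this

theorem not_badQuad_of_max {a b c d : ℕ} : (b < a → c < a → d < a → ¬ BadQuad a b c d) ∧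
    (a < d → b < d → c < d → ¬ BadQuad a b c d) := by
  unfold BadQuad; omega

theorem sepWord_cons_max (hS : ∀ a ∈ S, a < N) : SepWord (N :: S) ↔ SepWord S := by
  refine ⟨fun h => h.sublist (List.sublist_cons_self _ _), fun h a b c d hs => ?_⟩
  rcases List.sublist_cons_iff.1 hs with hs | ⟨r, hr, hs⟩
  · exact h a b c d hs
  · obtain ⟨rfl, rfl⟩ := List.cons.inj hr
    have := fun x hx => hS x (hs.subset hx)
    simp at this
    exact not_badQuad_of_max.1 this.1 this.2.1 this.2.2

theorem sepWord_append_max (hS : ∀ a ∈ S, a < N) : SepWord (S ++ [N]) ↔ SepWord S := by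
  refine ⟨fun h => h.sublist (List.sublist_append_left _ _), fun h a b c d hs => ?_⟩
  obtain ⟨x, y, hxy, hx, hy⟩ := List.sublist_append_iff.1 hs
  rcases List.sublist_singleton.1 hy with rfl | rfl
  · rw [List.append_nil] at hxy
    exact h a b c d (hxy ▸ hx)
  · have h4 : [a, b, c] ++ [d] = x ++ [N] := hxy
    obtain ⟨rfl, h5⟩ := List.append_inj' h4 rfl
    obtain rfl : d = N := by simpa using h5
    have := fun x hx' => hS x (hx.subset hx')
    simp at this
    exact not_badQuad_of_max.2 this.1 this.2.1 this.2.2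

theorem sepWord_map_add (m : ℕ) (l : List ℕ) : SepWord (l.map (· + m)) ↔ SepWord l := by
  constructor
  · intro h a b c d hs hbad
    refine h _ _ _ _ (hs.map (· + m)) ?_
    simp only [BadQuad] at hbad ⊢
    omega
  · intro h a b c d hs hbad
    obtain ⟨l', hl', he⟩ := List.sublist_map_iff.1 hs
    rcases l' with _ | ⟨a', _ | ⟨b', _ | ⟨c', _ | ⟨d', _ | ⟨e', l'⟩⟩⟩⟩⟩ <;> simp at he
    refine h _ _ _ _ hl' ?_
    unfold BadQuad at hbad ⊢
    omega

theorem sepWord_insert_right (hL : ∀ a ∈ L, a < m) (hR : ∀ a ∈ R, a < m) (hS : ∀ a ∈ S, m ≤ a)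
    (hSN : ∀ a ∈ S, a < N) (hmN : m ≤ N) :
    SepWord (L ++ N :: (S ++ R)) ↔ SepWord S ∧ SepWord (L ++ m :: R) := by
  rw [← List.cons_append, sepWord_block hL (m := m) (by simpa using ⟨hmN, hS⟩) hR (by simp),
    sepWord_cons_max hSN, List.singleton_append]

theorem sepWord_insert_left (hL : ∀ a ∈ L, a < m) (hR : ∀ a ∈ R, a < m) (hS : ∀ a ∈ S, m ≤ a)
    (hSN : ∀ a ∈ S, a < N) (hmN : m ≤ N) :
    SepWord ((L ++ S) ++ N :: R) ↔ SepWord S ∧ SepWord (L ++ m :: R) := by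
  have : (L ++ S) ++ N :: R = L ++ ((S ++ [N]) ++ R) := by simp
  rw [this, sepWord_block hL (m := m) _ hR (by simp), sepWord_append_max hSN,
    List.singleton_append]
  intro a ha
  rcases List.mem_append.1 ha with ha | ha
  · exact hS a ha
  · rw [List.mem_singleton.1 ha]; exact hmN

theorem avSep_insert_right {T : List ℕ} (hL : ∀ a ∈ L, a < m) (hR : ∀ a ∈ R, a < m)
    (hTN : ∀ a ∈ T, a + m < N) (hmN : m ≤ N) :
    AvSep k (L ++ N :: (T.map (· + m) ++ R)) ↔
      AvSep (k - L.length) T ∧ AvSep k (L ++ m :: R) := by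
  have hS : ∀ a ∈ T.map (· + m), m ≤ a := by simp
  have hSN : ∀ a ∈ T.map (· + m), a < N := by simpa using hTN
  have hLN : ∀ a ∈ L, a < N := fun a ha => (hL a ha).trans_le hmN
  have hRN : ∀ a ∈ T.map (· + m) ++ R, a < N := fun a ha => (List.mem_append.1 ha).elim (hSN a)
    fun h => (hR a h).trans_le hmN
  have h1 := avoidFrom_shift (k := k) (Q := []) (l := T) hL
  rw [List.map_nil, List.append_nil] at h1
  have h2 : AvoidFrom k (L ++ T.map (· + m)) R ↔ AvoidFrom k L R := by
    refine avoidFrom_congr fun x hx => ?_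
    have : ∀ a ∈ T.map (· + m), x ≤ a := fun a ha => (hR x hx).le.trans (hS a ha)
    rw [List.countP_append, countP_lt_eq_zero this, add_zero]
  rw [AvSep, AvSep, AvSep, sepWord_insert_right hL hR hS hSN hmN, sepWord_map_add,
    avoidFrom_word_iff hLN hRN, avoidFrom_word_iff hL hR, avoidFrom_append, h1, h2]
  tauto

theorem avSep_insert_left (hL : ∀ a ∈ L, a < m) (hR : ∀ a ∈ R, a < m) (hS : ∀ a ∈ S, m ≤ a)
    (hSN : ∀ a ∈ S, a < N) (hmN : m ≤ N) (hk : L.length + S.length + 1 < k) :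
    AvSep k ((L ++ S) ++ N :: R) ↔ SepWord S ∧ AvSep k (L ++ m :: R) := by
  have hRN : ∀ a ∈ R, a < N := fun a ha => (hR a ha).trans_le hmN
  have hLN : ∀ a ∈ L ++ S, a < N := fun a ha => (List.mem_append.1 ha).elim
    (fun h => (hL a h).trans_le hmN) (hSN a)
  have h2 : AvoidFrom k (L ++ S) R ↔ AvoidFrom k L R := by
    refine avoidFrom_congr fun x hx => ?_
    have : ∀ a ∈ S, x ≤ a := fun a ha => (hR x hx).le.trans (hS a ha)
    rw [List.countP_append, countP_lt_eq_zero this, add_zero]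
  rw [AvSep, AvSep, sepWord_insert_left hL hR hS hSN hmN,
    avoidFrom_word_iff hLN hRN, avoidFrom_word_iff hL hR, h2]
  have h3 : AvoidFrom k [] (L ++ S) := avoidFrom_of_length_lt (by simpa using hk)
  have h4 : AvoidFrom k [] L := avoidFrom_of_length_lt (by omega)
  have h5 : (L ++ S).length + 1 < k := by simpa using hk
  have h6 : L.length + 1 < k := by omega
  tauto

end

/-! ### Permutations as words -/

/-- The one-line notation of a permutation, as a word in `0, …, n - 1`. -/
def toWord {n : ℕ} (π : Equiv.Perm (Fin n)) : List ℕ := List.ofFn fun i => (π i : ℕ)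

open Classical in
theorem card_suffix_eq (r : ℕ → ℕ → Prop) [DecidableRel r] {n : ℕ} (f : Fin n → ℕ) :
    (Finset.univ.filter fun i => ∀ j, i < j → r (f j) (f i)).card = sufCount r (List.ofFn f) := by
  induction n with
  | zero => simp [sufCount]
  | succ n ih =>
    have h := ih (fun i => f i.succ)
    rw [List.ofFn_succ, sufCount, ← h, Fin.univ_succ, Finset.filter_cons]
    have h1 : (∀ j, 0 < j → r (f j) (f 0)) ↔
        ∀ b ∈ List.ofFn (fun i => f (Fin.succ i)), r b (f 0) := by
      simp [Fin.forall_fin_succ, List.mem_ofFn]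
    have h2 : (Finset.filter (fun i => ∀ j, i < j → r (f j) (f i))
        (Finset.map ⟨Fin.succ, Fin.succ_injective n⟩ Finset.univ)).card =
        (Finset.univ.filter fun i : Fin n => ∀ j, i < j → r (f j.succ) (f i.succ)).card := by
      rw [Finset.filter_map, Finset.card_map]
      congr 1
      ext i
      simp [Fin.forall_fin_succ]
    simp only [h1]
    split_ifs
    · rw [Finset.card_cons, ← h2, add_comm]
    · rw [← h2, zero_add]

open Classical in
theorem card_prefix_eq (r : ℕ → ℕ → Prop) [DecidableRel r] {n : ℕ} (f : Fin n → ℕ) :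
    (Finset.univ.filter fun i => ∀ j, j < i → r (f j) (f i)).card =
      sufCount r (List.ofFn f).reverse := by
  have h : (List.ofFn f).reverse = List.ofFn fun i => f i.rev :=
    List.ext_getElem (by simp) fun i h1 h2 => by
      simp only [List.getElem_reverse, List.getElem_ofFn, List.length_ofFn, Fin.rev]
      congr 2
      omega
  rw [h, ← card_suffix_eq]
  refine Finset.card_bij (fun i _ => i.rev) ?_ ?_ ?_
  · intro i hi
    simp only [Finset.mem_filter, Finset.mem_univ, true_and, Fin.rev_rev] at hi ⊢
    exact fun j hj => hi _ (by rw [← Fin.rev_rev i]; exact Fin.rev_lt_rev.2 hj)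
  · intro i _ j _ h
    exact Fin.rev_injective h
  · intro i hi
    refine ⟨i.rev, ?_, Fin.rev_rev i⟩
    simp only [Finset.mem_filter, Finset.mem_univ, true_and] at hi ⊢
    intro j hj
    have := hi j.rev (by rw [← Fin.rev_rev i]; exact Fin.rev_lt_rev.2 hj)
    rwa [Fin.rev_rev] at this

open Classical in
theorem card_steps_eq (r : ℕ → ℕ → Prop) [DecidableRel r] {n : ℕ} (f : Fin n → ℕ) :
    (Finset.univ.filter fun i : Fin n => ∃ j : Fin n, j.val = i.val + 1 ∧ r (f i) (f j)).card =
      steps r (List.ofFn f) := by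
  induction n with
  | zero => simp [steps]
  | succ n ih =>
    cases n with
    | zero =>
      simp [steps]
    | succ n =>
      have h := ih (fun i => f i.succ)
      rw [List.ofFn_succ] at h
      rw [List.ofFn_succ, List.ofFn_succ, steps, ← h, Fin.univ_succ, Finset.filter_cons]
      have h1 : (∃ j : Fin (n + 2), j.val = (0 : Fin (n + 2)).val + 1 ∧ r (f 0) (f j)) ↔
          r (f 0) (f (Fin.succ 0)) := by
        constructor
        · rintro ⟨j, hj, h⟩
          have : j = Fin.succ 0 := Fin.ext (by simpa using hj)
          exact this ▸ h
        · exact fun h => ⟨Fin.succ 0, by simp, h⟩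
      have h2 : (Finset.filter (fun i : Fin (n + 2) => ∃ j : Fin (n + 2), j.val = i.val + 1 ∧
          r (f i) (f j)) (Finset.map ⟨Fin.succ, Fin.succ_injective (n + 1)⟩ Finset.univ)).card =
          (Finset.univ.filter fun i : Fin (n + 1) => ∃ j : Fin (n + 1), j.val = i.val + 1 ∧
            r (f i.succ) (f j.succ)).card := by
        rw [Finset.filter_map, Finset.card_map]
        congr 1
        ext i
        simp [Fin.exists_fin_succ]
      simp only [h1]
      split_ifs
      · rw [Finset.card_cons, ← h2, add_comm]
      · rw [← h2, zero_add]

theorem weight_eq {n : ℕ} (π : Equiv.Perm (Fin n)) :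
    weight π = wt ![p, q, u, v, s, t] (toWord π) := by
  have h1 := card_steps_eq (· < ·) (fun i => (π i : ℕ))
  have h2 := card_steps_eq (· > ·) (fun i => (π i : ℕ))
  have h3 := card_prefix_eq (· < ·) (fun i => (π i : ℕ))
  have h4 := card_suffix_eq (· < ·) (fun i => (π i : ℕ))
  have h5 := card_prefix_eq (· > ·) (fun i => (π i : ℕ))
  have h6 := card_suffix_eq (· > ·) (fun i => (π i : ℕ))
  simp only [gt_iff_lt, Fin.val_fin_lt] at h1 h2 h3 h4 h5 h6
  rw [weight, wt, asc, des, lmax, rmax, lmin, rmin, h1, h2, h3, h4, h5, h6]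
  rfl

/-- Occurrences along order embeddings are subwords. -/
theorem exists_embedding_iff {m n : ℕ} (f : Fin n → ℕ) (Q : (Fin m → ℕ) → Prop) :
    (∃ e : Fin m ↪o Fin n, Q fun i => f (e i)) ↔
      ∃ w : Fin m → ℕ, (List.ofFn w).Sublist (List.ofFn f) ∧ Q w := by
  constructor
  · rintro ⟨e, he⟩
    refine ⟨_, ?_, he⟩
    rw [List.sublist_iff_exists_fin_orderEmbedding_get_eq]
    refine ⟨(Fin.castOrderIso (List.length_ofFn)).toOrderEmbedding.trans
      (e.trans (Fin.castOrderIso (List.length_ofFn (f := f)).symm).toOrderEmbedding), fun i => ?_⟩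
    simp
    rfl
  · rintro ⟨w, hw, hQ⟩
    rw [List.sublist_iff_exists_fin_orderEmbedding_get_eq] at hw
    obtain ⟨e, he⟩ := hw
    refine ⟨(Fin.castOrderIso (List.length_ofFn (f := w)).symm).toOrderEmbedding.trans
      (e.trans (Fin.castOrderIso (List.length_ofFn (f := f))).toOrderEmbedding), ?_⟩
    convert hQ using 1
    ext i
    have := he (Fin.cast (List.length_ofFn (f := w)).symm i)
    simp only [List.get_ofFn] at this
    exact this.symm

theorem separable_iff {n : ℕ} (π : Equiv.Perm (Fin n)) : Separable π ↔ SepWord (toWord π) := by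
  have h1 := exists_embedding_iff (fun i => (π i : ℕ))
    (fun w : Fin 4 → ℕ => ∀ i j, ![2, 4, 1, 3] i < ![2, 4, 1, 3] j ↔ w i < w j)
  have h2 := exists_embedding_iff (fun i => (π i : ℕ))
    (fun w : Fin 4 → ℕ => ∀ i j, ![3, 1, 4, 2] i < ![3, 1, 4, 2] j ↔ w i < w j)
  rw [Separable, ContainsPattern, ContainsPattern]
  simp only [Fin.val_fin_lt] at h1 h2
  rw [h1, h2, ← toWord]
  constructor
  · rintro ⟨g1, g2⟩ a b c d hs (hbad | hbad)
    · refine g1 ⟨![a, b, c, d], by simpa [List.ofFn_succ] using hs, ?_⟩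
      simp [Fin.forall_fin_succ]
      omega
    · refine g2 ⟨![a, b, c, d], by simpa [List.ofFn_succ] using hs, ?_⟩
      simp [Fin.forall_fin_succ]
      omega
  · intro h
    constructor
    · rintro ⟨w, hw, hQ⟩
      refine h (w 0) (w 1) (w 2) (w 3) (by simpa [List.ofFn_succ] using hw) (.inl ?_)
      exact ⟨(hQ 2 0).1 (by decide), (hQ 0 3).1 (by decide), (hQ 3 1).1 (by decide)⟩
    · rintro ⟨w, hw, hQ⟩
      refine h (w 0) (w 1) (w 2) (w 3) (by simpa [List.ofFn_succ] using hw) (.inr ?_)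
      exact ⟨(hQ 1 3).1 (by decide), (hQ 3 0).1 (by decide), (hQ 0 2).1 (by decide)⟩

theorem avoidFrom_iff_split {k : ℕ} {P l : List ℕ} :
    AvoidFrom k P l ↔ ∀ A x B, l = A ++ x :: B → (P ++ A).countP (· < x) + 1 < k := by
  constructor
  · rintro h A x B rfl
    exact ((avoidFrom_append k P A (x :: B)).1 h).2.1
  · intro h
    induction l generalizing P with
    | nil => trivial
    | cons x l ih =>
      refine ⟨by simpa using h [] x l rfl, ih fun A y B hl => ?_⟩
      simpa using h (x :: A) y B (by simp [hl])

/-- A word avoids the flat pattern of length `k` iff it has no subword of length `k` whose last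
letter is the largest. -/
theorem avoidFrom_nil_iff {k : ℕ} {l : List ℕ} :
    AvoidFrom (k + 1) [] l ↔
      ¬ ∃ w x, (w ++ [x]).Sublist l ∧ w.length = k ∧ ∀ y ∈ w, y < x := by
  rw [avoidFrom_iff_split]
  constructor
  · rintro h ⟨w, x, hs, rfl, hx⟩
    obtain ⟨A, B, rfl, hA, hB⟩ := List.append_sublist_iff.1 hs
    obtain ⟨C, D, rfl⟩ := List.append_of_mem (List.singleton_sublist.1 hB)
    have h1 := h (A ++ C) x D (by simp)
    have h2 := (hA.trans (List.sublist_append_left A C)).countP_le (p := (· < x))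
    rw [countP_lt_eq_length hx] at h2
    simp only [List.nil_append] at h1
    omega
  · rintro h A x B rfl
    by_contra hc
    rw [List.nil_append, List.countP_eq_length_filter] at hc
    refine h ⟨(A.filter (· < x)).take k, x, ?_, by rw [List.length_take]; omega, ?_⟩
    · exact ((List.take_sublist _ _).trans List.filter_sublist).append
        (List.singleton_sublist.2 (by simp))
    · intro y hy
      simpa using (List.mem_filter.1 (List.mem_of_mem_take hy)).2

theorem not_containsPOP_iff {k n : ℕ} (hk : 1 ≤ k) (π : Equiv.Perm (Fin n)) :
    ¬ ContainsPOP (flatPOP k) π ↔ AvoidFrom k [] (toWord π) := by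
  obtain ⟨k, rfl⟩ : ∃ k', k = k' + 1 := ⟨k - 1, by omega⟩
  have h1 := exists_embedding_iff (fun i => (π i : ℕ))
    (fun w : Fin (k + 1) → ℕ => ∀ i j, flatPOP (k + 1) i j → w i < w j)
  simp only [Fin.val_fin_lt] at h1
  rw [avoidFrom_nil_iff, ContainsPOP, h1, not_iff_not, ← toWord]
  constructor
  · rintro ⟨w, hw, hQ⟩
    refine ⟨List.ofFn fun i : Fin k => w i.castSucc, w (Fin.last k), ?_, by simp, ?_⟩
    · rwa [List.ofFn_succ_last] at hw
    · intro y hy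
      obtain ⟨i, rfl⟩ := List.mem_ofFn.1 hy
      exact hQ _ _ ⟨Fin.castSucc_lt_last i, rfl⟩
  · rintro ⟨w, x, hs, rfl, hx⟩
    refine ⟨Fin.snoc (fun i => w.get i) x, ?_, ?_⟩
    · rw [List.ofFn_succ_last]
      simpa using hs
    · rintro i j ⟨hij, hj⟩
      obtain rfl : j = Fin.last _ := Fin.ext (by simpa using hj)
      obtain ⟨i, rfl⟩ := Fin.exists_castSucc_eq.2 hij.ne
      simp only [Fin.snoc_castSucc, Fin.snoc_last]
      exact hx _ (List.get_mem _ _)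

theorem sepAvoid_iff {k n : ℕ} (hk : 1 ≤ k) (π : Equiv.Perm (Fin n)) :
    SepAvoid k π ↔ AvSep k (toWord π) :=
  and_congr (separable_iff π) (not_containsPOP_iff hk π)

/-- The one-line notations of the permutations of `0, …, n - 1`. -/
def words (n : ℕ) : Finset (List ℕ) := (List.range n).permutations.toFinset

theorem mem_words {n : ℕ} {l : List ℕ} : l ∈ words n ↔ l.Perm (List.range n) := by
  simp [words]

theorem toWord_mem_words {n : ℕ} (π : Equiv.Perm (Fin n)) : toWord π ∈ words n := by
  rw [mem_words, List.perm_ext_iff_of_nodup _ List.nodup_range]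
  · intro a
    simp only [toWord, List.mem_ofFn, List.mem_range]
    constructor
    · rintro ⟨i, rfl⟩
      exact (π i).isLt
    · exact fun ha => ⟨π.symm ⟨a, ha⟩, by simp⟩
  · exact List.nodup_ofFn.2 fun i j h => π.injective (Fin.ext h)

theorem exists_toWord_eq {n : ℕ} {l : List ℕ} (hl : l ∈ words n) :
    ∃ π : Equiv.Perm (Fin n), toWord π = l := by
  rw [mem_words] at hl
  obtain rfl : l.length = n := by simpa using hl.length_eq
  let f : Fin l.length → Fin l.length := fun i => ⟨l[i], by
    simpa using hl.subset (List.getElem_mem i.isLt)⟩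
  have hf : Function.Injective f := fun i j h =>
    Fin.ext ((hl.nodup_iff.2 List.nodup_range).getElem_inj_iff.1 (Fin.val_eq_of_eq h))
  refine ⟨Equiv.ofBijective f (Finite.injective_iff_bijective.1 hf), ?_⟩
  exact List.ofFn_getElem (xs := l)

theorem toWord_injective (n : ℕ) :
    Function.Injective (toWord : Equiv.Perm (Fin n) → List ℕ) := by
  intro π ρ h
  have h := List.ofFn_injective h
  exact Equiv.ext fun i => Fin.ext (congrFun h i)

theorem sum_weight_eq {n : ℕ} (P : Equiv.Perm (Fin n) → Prop) (Q : List ℕ → Prop)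
    {_ : DecidablePred P} {_ : DecidablePred Q} (h : ∀ π, P π ↔ Q (toWord π)) :
    ∑ π ∈ Finset.univ.filter P, weight π =
      ∑ l ∈ (words n).filter Q, wt ![p, q, u, v, s, t] l := by
  refine Finset.sum_nbij toWord ?_ (toWord_injective n).injOn ?_ fun π _ => weight_eq π
  · intro π hπ
    simp only [Finset.mem_filter, Finset.mem_univ, true_and] at hπ ⊢
    exact ⟨toWord_mem_words π, (h π).1 hπ⟩
  · intro l hl
    rw [Finset.mem_coe, Finset.mem_filter] at hl
    obtain ⟨π, rfl⟩ := exists_toWord_eq hl.1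
    exact ⟨π, by simpa using (h π).2 hl.2, rfl⟩

/-! ### Splitting a permutation at its largest entry -/

/-- The pairs `(L, R)` of words such that `L m R` is a permutation of `0, …, m`. -/
def pairs (m : ℕ) : Finset (List ℕ × List ℕ) :=
  (words m).biUnion fun l => (Finset.range (m + 1)).image fun i => (l.take i, l.drop i)

theorem mem_pairs {m : ℕ} {P : List ℕ × List ℕ} :
    P ∈ pairs m ↔ (P.1 ++ P.2).Perm (List.range m) := by
  obtain ⟨L, R⟩ := P
  simp only [pairs, Finset.mem_biUnion, mem_words, Finset.mem_image, Finset.mem_range,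
    Prod.mk.injEq]
  constructor
  · rintro ⟨l, hl, i, -, rfl, rfl⟩
    rwa [List.take_append_drop]
  · intro h
    refine ⟨L ++ R, h, L.length, ?_, by simp, by simp⟩
    have := h.length_eq
    simp at this
    omega

/-- The word `L m R` coded by the pair `(L, R)`, where `m` is the length of `L R`. -/
def wordOf (P : List ℕ × List ℕ) : List ℕ := P.1 ++ (P.1.length + P.2.length) :: P.2

/-- Some entry of `L` exceeds all entries of `R`; equivalently, in the word `L m R` the second
largest entry exists and stands to the left of `m`. -/
def LeftTop (P : List ℕ × List ℕ) : Prop := ∃ b ∈ P.1, ∀ c ∈ P.2, c < b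

theorem length_of_mem_pairs {m : ℕ} {L R : List ℕ} (h : (L, R) ∈ pairs m) :
    L.length + R.length = m := by
  simpa using (mem_pairs.1 h).length_eq

theorem lt_of_mem_left {m : ℕ} {L R : List ℕ} (h : (L, R) ∈ pairs m) : ∀ a ∈ L, a < m :=
  fun a ha => by simpa using (mem_pairs.1 h).subset (List.mem_append_left R ha)

theorem lt_of_mem_right {m : ℕ} {L R : List ℕ} (h : (L, R) ∈ pairs m) : ∀ a ∈ R, a < m :=
  fun a ha => by simpa using (mem_pairs.1 h).subset (List.mem_append_right L ha)

theorem ne_of_mem_pairs {m : ℕ} {L R : List ℕ} (h : (L, R) ∈ pairs m) {a b : ℕ} (ha : a ∈ L)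
    (hb : b ∈ R) : a ≠ b :=
  (List.nodup_append.1 ((mem_pairs.1 h).nodup_iff.2 List.nodup_range)).2.2 a ha b hb

theorem wordOf_eq {m : ℕ} {L R : List ℕ} (h : (L, R) ∈ pairs m) :
    wordOf (L, R) = L ++ m :: R := by
  rw [wordOf, length_of_mem_pairs h]

theorem wordOf_mem_words {m : ℕ} {P : List ℕ × List ℕ} (h : P ∈ pairs m) :
    wordOf P ∈ words (m + 1) := by
  obtain ⟨L, R⟩ := P
  rw [mem_words, wordOf_eq h, List.range_succ]
  exact List.perm_middle.trans
    (((mem_pairs.1 h).cons m).trans (List.perm_append_singleton m _).symm)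

theorem exists_wordOf_eq {m : ℕ} {l : List ℕ} (h : l ∈ words (m + 1)) :
    ∃ P ∈ pairs m, wordOf P = l := by
  rw [mem_words] at h
  obtain ⟨L, R, rfl⟩ := List.append_of_mem (h.mem_iff.2 (List.mem_range.2 m.lt_succ_self))
  have hP : (L, R) ∈ pairs m := by
    rw [mem_pairs]
    rw [List.range_succ] at h
    exact List.Perm.cons_inv
      ((List.perm_middle.symm.trans h).trans (List.perm_append_singleton m _))
  exact ⟨_, hP, wordOf_eq hP⟩

theorem wordOf_injOn (m : ℕ) : Set.InjOn wordOf (pairs m : Set (List ℕ × List ℕ)) := by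
  rintro ⟨L, R⟩ h ⟨L', R'⟩ h' he
  rw [Finset.mem_coe] at h h'
  rw [wordOf_eq h, wordOf_eq h', List.append_cons_inj_of_notMem] at he
  · rw [he.1, he.2.2]
  · exact fun hm => (lt_of_mem_left h m hm).false
  · exact fun hm => (lt_of_mem_right h m hm).false

theorem leftTop_iff {m : ℕ} {L R : List ℕ} (h : (L, R) ∈ pairs m) :
    LeftTop (L, R) ↔ ∃ b ∈ L, b + 1 = m := by
  constructor
  · rintro ⟨b, hb, hR⟩
    have hbm := lt_of_mem_left h b hb
    have : m - 1 ∈ L ++ R := (mem_pairs.1 h).mem_iff.2 (List.mem_range.2 (by omega))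
    rcases List.mem_append.1 this with h1 | h1
    · exact ⟨_, h1, by omega⟩
    · have := hR _ h1
      omega
  · rintro ⟨b, hb, rfl⟩
    refine ⟨b, hb, fun c hc => ?_⟩
    have h1 := lt_of_mem_right h c hc
    have h2 := ne_of_mem_pairs h hb hc
    omega

/-- Sums over permutations of length `m + 1` are sums over pairs. -/
theorem sum_weight_eq_sum_pairs {m : ℕ} (P : Equiv.Perm (Fin (m + 1)) → Prop)
    (D : List ℕ × List ℕ → Prop) {_ : DecidablePred P} {_ : DecidablePred D}
    (h : ∀ π, ∀ Y ∈ pairs m, toWord π = wordOf Y → (P π ↔ D Y)) :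
    ∑ π ∈ Finset.univ.filter P, weight π =
      ∑ Y ∈ (pairs m).filter D, wt ![p, q, u, v, s, t] (wordOf Y) := by
  classical
  rw [sum_weight_eq P fun l => ∃ Y ∈ pairs m, wordOf Y = l ∧ D Y]
  · symm
    refine Finset.sum_nbij wordOf ?_ ?_ ?_ fun _ _ => rfl
    · intro Y hY
      rw [Finset.mem_filter] at hY ⊢
      exact ⟨wordOf_mem_words hY.1, Y, hY.1, rfl, hY.2⟩
    · exact (wordOf_injOn m).mono fun Y hY => (Finset.mem_filter.1 hY).1
    · intro l hl
      obtain ⟨-, Y, h1, h2, h3⟩ := Finset.mem_filter.1 hl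
      exact ⟨Y, by simp [h1, h3], h2⟩
  · intro π
    constructor
    · intro hπ
      obtain ⟨Y, hY, he⟩ := exists_wordOf_eq (toWord_mem_words π)
      exact ⟨Y, hY, he, (h π Y hY he.symm).1 hπ⟩
    · rintro ⟨Y, hY, he, hD⟩
      exact (h π Y hY he.symm).2 hD

section
variable {m i : ℕ} {π : Equiv.Perm (Fin (m + 1))} {L R : List ℕ}

theorem apply_eq_getElem (hπ : toWord π = L ++ m :: R) (b : Fin (m + 1)) :
    (π b : ℕ) = (L ++ m :: R)[b.val]'(by rw [← hπ, toWord, List.length_ofFn]; exact b.isLt) := by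
  simp only [← hπ, toWord, List.getElem_ofFn]

/-- The position of the largest entry. -/
theorem max_position (h : (L, R) ∈ pairs m) (hπ : toWord π = L ++ m :: R) (a : Fin (m + 1)) :
    (π a).val + 1 = m + 1 ↔ a.val = L.length := by
  have hl := length_of_mem_pairs h
  have h0 : (π ⟨L.length, by omega⟩ : ℕ) = m := by
    rw [apply_eq_getElem hπ]; simp
  constructor
  · intro ha
    have : π a = π ⟨L.length, by omega⟩ := Fin.ext (by omega)
    exact congrArg Fin.val (π.injective this)
  · intro ha
    have : a = ⟨L.length, by omega⟩ := Fin.ext ha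
    rw [this, h0]

theorem leftTop_iff_position (h : (L, R) ∈ pairs m) (hπ : toWord π = L ++ m :: R) :
    LeftTop (L, R) ↔ ∃ b : Fin (m + 1), (π b).val + 2 = m + 1 ∧ b.val < L.length := by
  have hl := length_of_mem_pairs h
  rw [leftTop_iff h]
  constructor
  · rintro ⟨b, hb, hm⟩
    obtain ⟨j, hj, rfl⟩ := List.getElem_of_mem hb
    refine ⟨⟨j, by omega⟩, ?_, hj⟩
    rw [apply_eq_getElem hπ]
    simp only [List.getElem_append_left hj]
    omega
  · rintro ⟨b, hb, hbL⟩
    refine ⟨_, List.getElem_mem hbL, ?_⟩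
    rw [apply_eq_getElem hπ, List.getElem_append_left hbL] at hb
    omega

theorem maxThenSecond_iff (h : (L, R) ∈ pairs m) (hπ : toWord π = L ++ m :: R) :
    MaxThenSecond i π ↔ L.length = i ∧ ¬ LeftTop (L, R) := by
  have hl := length_of_mem_pairs h
  rw [leftTop_iff_position h hπ]
  constructor
  · rintro ⟨a, ha, rfl, hb⟩
    rw [max_position h hπ] at ha
    refine ⟨ha.symm, ?_⟩
    rintro ⟨b, h1, h2⟩
    have := hb b h1
    rw [Fin.lt_def] at this
    omega
  · rintro ⟨rfl, hb⟩
    refine ⟨⟨L.length, by omega⟩, (max_position h hπ _).2 rfl, rfl, fun b h1 => ?_⟩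
    have h2 : ¬ b.val < L.length := fun h2 => hb ⟨b, h1, h2⟩
    have h3 : b.val ≠ L.length := fun h3 => by
      have := (max_position h hπ b).2 h3
      omega
    rw [Fin.lt_def]
    dsimp only
    omega

theorem secondThenMax_iff (h : (L, R) ∈ pairs m) (hπ : toWord π = L ++ m :: R) :
    SecondThenMax i π ↔ L.length = i ∧ LeftTop (L, R) := by
  have hl := length_of_mem_pairs h
  rw [leftTop_iff_position h hπ]
  constructor
  · rintro ⟨a, ha, rfl, b, h1, h2⟩
    rw [max_position h hπ] at ha
    exact ⟨ha.symm, b, h1, ha ▸ h2⟩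
  · rintro ⟨rfl, b, h1, h2⟩
    exact ⟨⟨L.length, by omega⟩, (max_position h hπ _).2 rfl, rfl, b, h1, h2⟩

end

/-! ### Generating functions of classes of words and of pairs -/

/-- The generating function of the weighted class with `S n` as its objects of size `n`. -/
noncomputable def gf {α : Type*} (S : ℕ → Finset α) (w : α → Poly) : Series :=
  PowerSeries.mk fun n => ∑ a ∈ S n, w a

open Classical in
/-- The words of the permutations of `0, …, n - 1` that satisfy `Q`. -/
noncomputable def wordClass (Q : List ℕ → Prop) (n : ℕ) : Finset (List ℕ) := (words n).filter Q

open Classical in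
/-- The pairs `(L, R)` that satisfy `Q`; the size of a pair is the length of `L R`, one less than
that of the permutation it codes. -/
noncomputable def pairClass (Q : List ℕ × List ℕ → Prop) (n : ℕ) : Finset (List ℕ × List ℕ) :=
  (pairs n).filter Q

theorem mem_wordClass {Q : List ℕ → Prop} {n : ℕ} {l : List ℕ} :
    l ∈ wordClass Q n ↔ l ∈ words n ∧ Q l := by
  simp [wordClass]

theorem mem_pairClass {Q : List ℕ × List ℕ → Prop} {n : ℕ} {P : List ℕ × List ℕ} :
    P ∈ pairClass Q n ↔ P ∈ pairs n ∧ Q P := by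
  simp [pairClass]

/-- The weight of the word coded by a pair. -/
noncomputable abbrev pairWt (P : List ℕ × List ℕ) : Poly := wt ![p, q, u, v, s, t] (wordOf P)

theorem genF_eq {k : ℕ} (hk : 1 ≤ k) :
    genF k = gf (wordClass (AvSep k)) (wt ![p, q, u, v, s, t]) := by
  ext1 n
  simp only [genF, gf, PowerSeries.coeff_mk, wordClass]
  exact sum_weight_eq _ _ fun π => sepAvoid_iff hk π

theorem X_eq (n : ℕ) : X n = ∑ l ∈ wordClass SepWord n, wt ![p, q, u, v, s, t] l :=
  sum_weight_eq _ _ fun π => separable_iff π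

theorem sum_weight_eq_zero {n : ℕ} (P : Equiv.Perm (Fin n) → Prop) {_ : DecidablePred P}
    (h : ∀ π, ¬ P π) : ∑ π ∈ Finset.univ.filter P, weight π = 0 :=
  Finset.sum_eq_zero fun π hπ => absurd (Finset.mem_filter.1 hπ).2 (h π)

theorem genf_eq {k : ℕ} (hk : 1 ≤ k) (i : ℕ) :
    genf k i = x * gf (pairClass fun P => P.1.length = i ∧ AvSep k (wordOf P) ∧ ¬ LeftTop P)
      pairWt := by
  ext1 n
  cases n with
  | zero =>
    simp only [genf, x, PowerSeries.coeff_mk, PowerSeries.coeff_zero_X_mul]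
    refine sum_weight_eq_zero _ ?_
    rintro π ⟨-, a, -⟩
    exact a.elim0
  | succ m =>
    simp only [genf, gf, x, PowerSeries.coeff_mk, PowerSeries.coeff_succ_X_mul, pairClass]
    refine sum_weight_eq_sum_pairs _ _ ?_
    rintro π ⟨L, R⟩ hY he
    rw [sepAvoid_iff hk, maxThenSecond_iff hY (he.trans (wordOf_eq hY)), he]
    tauto

theorem geng_eq {k : ℕ} (hk : 1 ≤ k) (i : ℕ) :
    geng k i = x * gf (pairClass fun P => P.1.length = i ∧ AvSep k (wordOf P) ∧ LeftTop P)
      pairWt := by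
  ext1 n
  cases n with
  | zero =>
    simp only [geng, x, PowerSeries.coeff_mk, PowerSeries.coeff_zero_X_mul]
    refine sum_weight_eq_zero _ ?_
    rintro π ⟨-, a, -⟩
    exact a.elim0
  | succ m =>
    simp only [geng, gf, x, PowerSeries.coeff_mk, PowerSeries.coeff_succ_X_mul, pairClass]
    refine sum_weight_eq_sum_pairs _ _ ?_
    rintro π ⟨L, R⟩ hY he
    rw [sepAvoid_iff hk, secondThenMax_iff hY (he.trans (wordOf_eq hY)), he]
    tauto

theorem wt_nil (a : Fin 6 → Poly) : wt a [] = 1 := by simp [wt, steps, sufCount]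

theorem words_zero : words 0 = {[]} := by
  ext l; simp [mem_words]

theorem genF_eq_one_add {k : ℕ} (hk : 1 ≤ k) :
    genF k = 1 + x * gf (pairClass fun P => AvSep k (wordOf P)) pairWt := by
  ext1 n
  cases n with
  | zero =>
    rw [genF_eq hk]
    have h : wordClass (AvSep k) 0 = {[]} := by
      ext l
      rw [mem_wordClass, words_zero, Finset.mem_singleton]
      exact and_iff_left_of_imp fun h => h ▸ ⟨sepWord_nil, trivial⟩
    simp [gf, x, h, wt_nil]
  | succ m =>
    rw [map_add, PowerSeries.coeff_one, if_neg m.succ_ne_zero, zero_add]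
    simp only [genF, gf, x, PowerSeries.coeff_mk, PowerSeries.coeff_succ_X_mul, pairClass]
    refine sum_weight_eq_sum_pairs _ _ ?_
    rintro π ⟨L, R⟩ hY he
    rw [sepAvoid_iff hk, he]

section
variable {α β γ : Type*}

theorem gf_congr {S T : ℕ → Finset α} {w w' : α → Poly} (h : ∀ n, S n = T n)
    (hw : ∀ n, ∀ a ∈ T n, w a = w' a) : gf S w = gf T w' := by
  ext1 n
  simp only [gf, PowerSeries.coeff_mk, h]
  exact Finset.sum_congr rfl (hw n)

theorem gf_const_mul (S : ℕ → Finset α) (b : Poly) (w : α → Poly) :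
    gf S (fun a => b * w a) = c b * gf S w := by
  ext1 n
  simp [gf, c, Finset.mul_sum]

/-- The product rule: a size-preserving bijection from pairs of objects, along which the weight is
multiplicative. -/
theorem gf_eq_mul {S : ℕ → Finset α} {T : ℕ → Finset β} {U : ℕ → Finset γ} (φ : α → β → γ)
    {w : γ → Poly} {w₁ : α → Poly} {w₂ : β → Poly}
    (hmap : ∀ i j, ∀ a ∈ S i, ∀ b ∈ T j, φ a b ∈ U (i + j))
    (hinj : ∀ i j i' j', ∀ a ∈ S i, ∀ b ∈ T j, ∀ a' ∈ S i', ∀ b' ∈ T j', φ a b = φ a' b' →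
      i = i' ∧ j = j' ∧ a = a' ∧ b = b')
    (hsurj : ∀ n, ∀ d ∈ U n, ∃ i j a b, i + j = n ∧ a ∈ S i ∧ b ∈ T j ∧ φ a b = d)
    (hw : ∀ i j, ∀ a ∈ S i, ∀ b ∈ T j, w (φ a b) = w₁ a * w₂ b) :
    gf U w = gf S w₁ * gf T w₂ := by
  ext1 n
  simp only [PowerSeries.coeff_mul, gf, PowerSeries.coeff_mk, Finset.sum_mul_sum,
    ← Finset.sum_product']
  rw [Finset.sum_sigma']
  symm
  refine Finset.sum_nbij (fun z => φ z.2.1 z.2.2) ?_ ?_ ?_ ?_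
  · rintro ⟨⟨i, j⟩, a, b⟩ h
    simp only [Finset.mem_sigma, Finset.mem_product] at h
    rw [Finset.HasAntidiagonal.mem_antidiagonal] at h
    exact h.1 ▸ hmap i j a h.2.1 b h.2.2
  · rintro ⟨⟨i, j⟩, a, b⟩ h ⟨⟨i', j'⟩, a', b'⟩ h' he
    simp only [Finset.coe_sigma, Set.mem_sigma_iff, Finset.mem_coe,
      Finset.mem_product] at h h'
    obtain ⟨rfl, rfl, rfl, rfl⟩ := hinj i j i' j' a h.2.1 b h.2.2 a' h'.2.1 b' h'.2.2 he
    rfl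
  · intro d hd
    obtain ⟨i, j, a, b, h1, h2, h3, h4⟩ := hsurj n d hd
    exact ⟨⟨(i, j), a, b⟩, by simp [h1, h2, h3], h4⟩
  · rintro ⟨⟨i, j⟩, a, b⟩ h
    simp only [Finset.mem_sigma, Finset.mem_product] at h
    exact (hw i j a h.2.1 b h.2.2).symm

end

theorem gf_pairClass_split (Q D : List ℕ × List ℕ → Prop) (w : List ℕ × List ℕ → Poly) :
    gf (pairClass Q) w =
      gf (pairClass fun P => Q P ∧ D P) w + gf (pairClass fun P => Q P ∧ ¬ D P) w := by
  classical
  ext1 n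
  simp only [gf, map_add, PowerSeries.coeff_mk, pairClass]
  rw [← Finset.sum_filter_add_sum_filter_not ((pairs n).filter Q) D]
  simp only [Finset.filter_filter]
  congr!

/-- The sum rule over the values of a statistic. -/
theorem gf_pairClass_fiber (Q : List ℕ × List ℕ → Prop) (w : List ℕ × List ℕ → Poly)
    (st : List ℕ × List ℕ → ℕ) (I : Finset ℕ) (h : ∀ n, ∀ P ∈ pairs n, Q P → st P ∈ I) :
    gf (pairClass Q) w = ∑ j ∈ I, gf (pairClass fun P => Q P ∧ st P = j) w := by
  classical
  ext1 n
  simp only [gf, map_sum, PowerSeries.coeff_mk, pairClass]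
  rw [← Finset.sum_fiberwise_of_maps_to (s := (pairs n).filter Q) (t := I) (g := st)]
  · simp only [Finset.filter_filter]
    congr!
  · intro P hP
    rw [Finset.mem_filter] at hP
    exact h n P hP.1 hP.2

theorem polyAt_wt (a : Fin 6 → Poly) (l : List ℕ) :
    polyAt a (wt ![p, q, u, v, s, t] l) = wt a l := by
  simp [polyAt, wt, p, q, u, v, s, t]

theorem serAt_genF_sub_one {k : ℕ} (hk : 1 ≤ k) (a : Fin 6 → Poly) :
    serAt a (genF k) - 1 = gf (wordClass fun l => l ≠ [] ∧ AvSep k l) (wt a) := by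
  rw [sub_eq_iff_eq_add, genF_eq hk]
  ext1 n
  have h : PowerSeries.coeff n (serAt a (gf (wordClass (AvSep k)) (wt ![p, q, u, v, s, t]))) =
      ∑ l ∈ wordClass (AvSep k) n, wt a l := by
    simp only [serAt, gf, PowerSeries.coeff_map, PowerSeries.coeff_mk]
    simp [map_sum, polyAt_wt]
  rw [h, map_add, PowerSeries.coeff_one]
  simp only [gf, PowerSeries.coeff_mk]
  split_ifs with hn
  · subst hn
    have h0 : wordClass (AvSep k) 0 = {[]} := by
      ext l
      rw [mem_wordClass, words_zero, Finset.mem_singleton]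
      exact and_iff_left_of_imp fun h => h ▸ ⟨sepWord_nil, trivial⟩
    have h1 : wordClass (fun l => l ≠ [] ∧ AvSep k l) 0 = ∅ := by
      ext l
      simp [mem_wordClass, words_zero]
      tauto
    simp [h0, h1, wt_nil]
  · rw [add_zero]
    refine Finset.sum_congr ?_ fun _ _ => rfl
    ext l
    rw [mem_wordClass, mem_wordClass]
    refine and_congr_right fun hl => (and_iff_right_of_imp fun _ h0 => ?_).symm
    subst h0
    have := (mem_words.1 hl).length_eq
    simp at this
    omega

theorem gf_sep_length (a : Fin 6 → Poly) (i : ℕ) :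
    gf (wordClass fun l => SepWord l ∧ l.length = i) (wt a) = c (polyAt a (X i)) * x ^ i := by
  ext1 n
  rw [X_eq, map_sum, c, x, PowerSeries.coeff_C_mul, PowerSeries.coeff_X_pow]
  simp only [gf, PowerSeries.coeff_mk, polyAt_wt]
  split_ifs with hn
  · subst hn
    rw [mul_one]
    refine Finset.sum_congr ?_ fun _ _ => rfl
    ext l
    rw [mem_wordClass, mem_wordClass]
    refine and_congr_right fun hl => and_iff_left ?_
    simpa using (mem_words.1 hl).length_eq
  · rw [mul_zero]
    refine Finset.sum_eq_zero fun l hl => ?_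
    rw [mem_wordClass] at hl
    have := (mem_words.1 hl.1).length_eq
    simp at this
    omega

/-! ### Inserting a block next to the largest entry -/

/-- A permutation whose first entries are below its last entries is a direct sum. -/
theorem perm_range_split {A B : List ℕ} {n : ℕ} (h : (A ++ B).Perm (List.range n))
    (hAB : ∀ a ∈ A, ∀ b ∈ B, a < b) :
    A.Perm (List.range A.length) ∧
      ∃ σ : List ℕ, σ.Perm (List.range B.length) ∧ B = σ.map (· + A.length) := by
  have hn : A.length + B.length = n := by simpa using h.length_eq
  have hnd := h.nodup_iff.2 List.nodup_range
  have hA : A.Perm (List.range A.length) := by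
    rw [List.perm_ext_iff_of_nodup (List.nodup_append.1 hnd).1 List.nodup_range]
    have hsub : A.toFinset ⊆ Finset.range A.length := by
      intro a ha
      have hdown : Finset.range (a + 1) ⊆ A.toFinset := by
        intro b hb
        rw [List.mem_toFinset] at ha ⊢
        rw [Finset.mem_range] at hb
        have ha' : a < n := by simpa using h.subset (List.mem_append_left B ha)
        have hb' : b ∈ A ++ B := h.mem_iff.2 (List.mem_range.2 (by omega))
        rcases List.mem_append.1 hb' with h1 | h1
        · exact h1
        · have := hAB a ha b h1
          omega
      have := (Finset.card_le_card hdown).trans (List.toFinset_card_le A)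
      rw [Finset.card_range] at this
      exact Finset.mem_range.2 this
    have heq := Finset.eq_of_subset_of_card_le hsub
      (by rw [Finset.card_range, List.toFinset_card_of_nodup (List.nodup_append.1 hnd).1])
    intro a
    rw [← List.mem_toFinset, heq, Finset.mem_range, List.mem_range]
  have hB : B.Perm ((List.range B.length).map (A.length + ·)) := by
    rw [← hn, List.range_add] at h
    exact (List.perm_append_left_iff A).1 (h.trans (hA.symm.append_right _))
  refine ⟨hA, B.map (· - A.length), ?_, ?_⟩
  · have := hB.map (· - A.length)
    simpa [List.map_map, Function.comp_def] using this
  · rw [List.map_map]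
    refine (List.map_id B).symm.trans (List.map_congr_left fun b hb => ?_)
    obtain ⟨j, -, rfl⟩ := List.mem_map.1 (hB.subset hb)
    simp only [id, Function.comp]
    omega

theorem eq_filter_append_filter {P : ℕ → Prop} [DecidablePred P] {l : List ℕ}
    (h : ∀ b c, [b, c].Sublist l → P c → P b) :
    l = l.filter (P ·) ++ l.filter (¬ P ·) := by
  induction l with
  | nil => rfl
  | cons a l ih =>
    have ih' := ih fun b c hs => h b c (hs.trans (List.sublist_cons_self a l))
    by_cases ha : P a
    · simpa [ha] using ih'
    · have hl : ∀ c ∈ l, ¬ P c := fun c hc hPc =>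
        ha (h a c (List.cons_sublist_cons.2 (List.singleton_sublist.2 hc)) hPc)
      have h1 : l.filter (P ·) = [] := by simpa using hl
      have h2 : l.filter (¬ P ·) = l := by simpa using hl
      simp only [List.filter_cons, ha, decide_false, decide_true, not_false_eq_true, h1, h2]
      simp

theorem exists_max_of_ne_nil {l : List ℕ} (h : l ≠ []) : ∃ a ∈ l, ∀ b ∈ l, b ≤ a :=
  ⟨_, List.max_mem h, fun _ hb => List.le_max_of_mem hb⟩

/-- The words `σ` and `L m R` are combined into `L N σ' R`, where the values of `σ'` lie between
those of `L`, `R` and the largest value `N`. -/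
def insertRight (P : List ℕ × List ℕ) (σ : List ℕ) : List ℕ × List ℕ :=
  (P.1, σ.map (· + (P.1.length + P.2.length)) ++ P.2)

/-- The words `σ` and `L m R` are combined into `L σ' N R`, where the values of `σ'` lie between
those of `L`, `R` and the largest value `N`. -/
def insertLeft (P : List ℕ × List ℕ) (σ : List ℕ) : List ℕ × List ℕ :=
  (P.1 ++ σ.map (· + (P.1.length + P.2.length)), P.2)

/-- The number of entries of `L` that exceed all entries of `R`. -/
def topCount (P : List ℕ × List ℕ) : ℕ := (P.1.filter fun b => ∀ c ∈ P.2, c < b).length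

section
variable {L R σ : List ℕ} {m j k n : ℕ}

theorem map_add_perm (h : (L ++ R).Perm (List.range m)) (hσ : σ ∈ words j) :
    ((L ++ R) ++ σ.map (· + m)).Perm (List.range (m + j)) := by
  rw [List.range_add]
  refine h.append ?_
  simpa [add_comm] using (mem_words.1 hσ).map (· + m)

theorem lt_of_mem_words (hσ : σ ∈ words j) : ∀ a ∈ σ, a < j :=
  fun a ha => by simpa using (mem_words.1 hσ).subset ha

theorem insertRight_mem_pairs (h : (L, R) ∈ pairs m) (hσ : σ ∈ words j) :
    insertRight (L, R) σ ∈ pairs (m + j) := by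
  rw [mem_pairs, insertRight, length_of_mem_pairs h]
  refine List.Perm.trans ?_ (map_add_perm (mem_pairs.1 h) hσ)
  rw [List.append_assoc]
  exact List.perm_append_comm.append_left L

theorem insertLeft_mem_pairs (h : (L, R) ∈ pairs m) (hσ : σ ∈ words j) :
    insertLeft (L, R) σ ∈ pairs (m + j) := by
  rw [mem_pairs, insertLeft, length_of_mem_pairs h]
  refine List.Perm.trans ?_ (map_add_perm (mem_pairs.1 h) hσ)
  rw [List.append_assoc, List.append_assoc]
  exact List.perm_append_comm.append_left L

theorem wordOf_insertRight (h : (L, R) ∈ pairs m) (hσ : σ ∈ words j) :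
    wordOf (insertRight (L, R) σ) = L ++ (m + j) :: (σ.map (· + m) ++ R) := by
  have := insertRight_mem_pairs h hσ
  rw [insertRight] at this ⊢
  rw [wordOf_eq this, length_of_mem_pairs h]

theorem wordOf_insertLeft (h : (L, R) ∈ pairs m) (hσ : σ ∈ words j) :
    wordOf (insertLeft (L, R) σ) = (L ++ σ.map (· + m)) ++ (m + j) :: R := by
  have := insertLeft_mem_pairs h hσ
  rw [insertLeft] at this ⊢
  rw [wordOf_eq this, length_of_mem_pairs h]

theorem avSep_insertRight (h : (L, R) ∈ pairs m) (hσ : σ ∈ words j) :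
    AvSep k (wordOf (insertRight (L, R) σ)) ↔
      AvSep (k - L.length) σ ∧ AvSep k (wordOf (L, R)) := by
  rw [wordOf_insertRight h hσ, wordOf_eq h]
  refine avSep_insert_right (lt_of_mem_left h) (lt_of_mem_right h) (fun a ha => ?_) (by omega)
  have := lt_of_mem_words hσ a ha
  omega

theorem avSep_insertLeft (h : (L, R) ∈ pairs m) (hσ : σ ∈ words j)
    (hk : L.length + σ.length + 1 < k) :
    AvSep k (wordOf (insertLeft (L, R) σ)) ↔ SepWord σ ∧ AvSep k (wordOf (L, R)) := by
  rw [wordOf_insertLeft h hσ, wordOf_eq h, ← sepWord_map_add m σ]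
  refine avSep_insert_left (lt_of_mem_left h) (lt_of_mem_right h) (by simp) ?_ (by omega)
    (by simpa using hk)
  intro a ha
  obtain ⟨b, hb, rfl⟩ := List.mem_map.1 ha
  have := lt_of_mem_words hσ b hb
  omega

/-- After insertion on the right, the entries of the right part above `L` are those of the block. -/
theorem filter_insertRight (h : (L, R) ∈ pairs m) (hLT : LeftTop (L, R)) :
    (insertRight (L, R) σ).2.filter (fun c => ∀ b ∈ L, b < c) = σ.map (· + m) := by
  obtain ⟨b, hb, hR⟩ := hLT
  rw [insertRight, List.filter_append, length_of_mem_pairs h, List.filter_eq_self.2,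
    List.filter_eq_nil_iff.2, List.append_nil]
  · intro c hc
    simpa using ⟨b, hb, (hR c hc).le⟩
  · intro c hc
    obtain ⟨d, -, rfl⟩ := List.mem_map.1 hc
    simpa using fun b hb => (lt_of_mem_left h b hb).trans_le (Nat.le_add_left m d)

theorem filter_insertLeft (h : (L, R) ∈ pairs m) (hLT : ¬ LeftTop (L, R)) :
    (insertLeft (L, R) σ).1.filter (fun b => ∀ c ∈ R, c < b) = σ.map (· + m) := by
  rw [insertLeft, List.filter_append, length_of_mem_pairs h, List.filter_eq_nil_iff.2,
    List.filter_eq_self.2, List.nil_append]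
  · intro c hc
    obtain ⟨d, -, rfl⟩ := List.mem_map.1 hc
    simpa using fun b hb => (lt_of_mem_right h b hb).trans_le (Nat.le_add_left m d)
  · intro b hb hc
    exact hLT ⟨b, hb, by simpa using hc⟩

theorem map_add_injective (m : ℕ) : Function.Injective (List.map (· + m)) :=
  List.map_injective_iff.2 (add_left_injective m)

theorem insertRight_injective {L' R' σ' : List ℕ} {m' : ℕ} (h : (L, R) ∈ pairs m)
    (h' : (L', R') ∈ pairs m') (hLT : LeftTop (L, R)) (hLT' : LeftTop (L', R'))
    (he : insertRight (L, R) σ = insertRight (L', R') σ') :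
    m = m' ∧ (L, R) = (L', R') ∧ σ = σ' := by
  have h1 : L = L' := congrArg Prod.fst he
  subst h1
  have h2 := filter_insertRight (σ := σ) h hLT
  rw [he, filter_insertRight h' hLT'] at h2
  have h3 := congrArg Prod.snd he
  rw [insertRight, insertRight, length_of_mem_pairs h, length_of_mem_pairs h', h2] at h3
  obtain rfl := List.append_cancel_left h3
  obtain rfl : m = m' := by rw [← length_of_mem_pairs h, ← length_of_mem_pairs h']
  exact ⟨rfl, rfl, map_add_injective m h2.symm⟩

theorem insertLeft_injective {L' R' σ' : List ℕ} {m' : ℕ} (h : (L, R) ∈ pairs m)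
    (h' : (L', R') ∈ pairs m') (hLT : ¬ LeftTop (L, R)) (hLT' : ¬ LeftTop (L', R'))
    (he : insertLeft (L, R) σ = insertLeft (L', R') σ') :
    m = m' ∧ (L, R) = (L', R') ∧ σ = σ' := by
  have h1 : R = R' := congrArg Prod.snd he
  subst h1
  have h2 := filter_insertLeft (σ := σ) h hLT
  rw [he, filter_insertLeft h' hLT'] at h2
  have h3 := congrArg Prod.fst he
  rw [insertLeft, insertLeft, length_of_mem_pairs h, length_of_mem_pairs h', h2] at h3
  obtain rfl := List.append_cancel_right h3
  obtain rfl : m = m' := by rw [← length_of_mem_pairs h, ← length_of_mem_pairs h']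
  exact ⟨rfl, rfl, map_add_injective m h2.symm⟩

theorem topCount_insertLeft (h : (L, R) ∈ pairs m) (hLT : ¬ LeftTop (L, R)) :
    topCount (insertLeft (L, R) σ) = σ.length := by
  have h1 := congrArg List.length (filter_insertLeft (σ := σ) h hLT)
  rw [List.length_map] at h1
  exact h1

theorem not_leftTop_insertRight (h : (L, R) ∈ pairs m) (hσ : σ ≠ []) :
    ¬ LeftTop (insertRight (L, R) σ) := by
  rintro ⟨b, hb, hc⟩
  obtain ⟨a, ha⟩ := List.exists_mem_of_ne_nil σ hσ
  have h1 := hc (a + m) (by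
    rw [insertRight, length_of_mem_pairs h]
    exact List.mem_append_left _ (List.mem_map_of_mem ha))
  have h2 := lt_of_mem_left h b hb
  omega

theorem leftTop_insertLeft (h : (L, R) ∈ pairs m) (hσ : σ ≠ []) :
    LeftTop (insertLeft (L, R) σ) := by
  obtain ⟨a, ha⟩ := List.exists_mem_of_ne_nil σ hσ
  refine ⟨a + m, ?_, fun c hc => ?_⟩
  · rw [insertLeft, length_of_mem_pairs h]
    exact List.mem_append_right _ (List.mem_map_of_mem ha)
  · have := lt_of_mem_right h c hc
    omega

/-- Avoidance of `2413` with the largest entry as `4` forces the entries of the right part above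
`L` to come first. -/
theorem exists_insertRight_eq {Y : List ℕ × List ℕ} (h : Y ∈ pairs n) (hs : SepWord (wordOf Y))
    (h0 : Y.1 ≠ []) (hLT : ¬ LeftTop Y) :
    ∃ i j P σ, i + j = n ∧ P ∈ pairs i ∧ LeftTop P ∧ P.1 = Y.1 ∧ σ ∈ words j ∧ σ ≠ [] ∧
      insertRight P σ = Y := by
  obtain ⟨L, R'⟩ := Y
  obtain ⟨a, ha, hmax⟩ := exists_max_of_ne_nil h0
  rw [wordOf_eq h] at hs
  have hsplit : R' = R'.filter (fun c => ∀ b ∈ L, b < c) ++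
      R'.filter (fun c => ¬ ∀ b ∈ L, b < c) := by
    refine eq_filter_append_filter fun b c hbc hc => ?_
    by_contra hb
    push Not at hb
    obtain ⟨b', hb', hbb'⟩ := hb
    have h1 : b ≤ a := hbb'.trans (hmax b' hb')
    have h2 : a ≠ b := ne_of_mem_pairs h ha (hbc.subset (by simp))
    have h3 := hc a ha
    have h4 : c < n := lt_of_mem_right h c (hbc.subset (by simp))
    -- `a n b c` is an occurrence of `2413`.
    refine hs a n b c ?_ (.inl ⟨by omega, h3, h4⟩)
    exact (List.singleton_sublist.2 ha).append (List.cons_sublist_cons.2 hbc)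
  set R1 := R'.filter (fun c => ∀ b ∈ L, b < c) with hR1
  set R2 := R'.filter (fun c => ¬ ∀ b ∈ L, b < c) with hR2
  have hR1L : ∀ c ∈ R1, ∀ b ∈ L, b < c := fun c hc => by
    simpa using (List.mem_filter.1 hc).2
  have hR2a : ∀ c ∈ R2, c < a := fun c hc => by
    obtain ⟨hcR, hc⟩ := List.mem_filter.1 hc
    simp only [not_forall, not_lt, decide_eq_true_eq] at hc
    obtain ⟨b, hb, hcb⟩ := hc
    have h1 := hmax b hb
    have h2 := ne_of_mem_pairs h ha hcR
    omega
  have hperm : ((L ++ R2) ++ R1).Perm (List.range n) := by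
    refine List.Perm.trans ?_ (mem_pairs.1 h)
    dsimp only
    conv_rhs => rw [hsplit]
    rw [List.append_assoc]
    exact List.perm_append_comm.append_left L
  obtain ⟨hA, σ, hσ, hσ'⟩ := perm_range_split hperm fun x hx c hc => by
    rcases List.mem_append.1 hx with hx | hx
    · exact hR1L c hc x hx
    · exact (hR2a x hx).trans (hR1L c hc a ha)
  rw [List.length_append] at hσ'
  refine ⟨(L ++ R2).length, R1.length, (L, R2), σ,
    List.length_append.symm.trans (hperm.length_eq.trans List.length_range),
    mem_pairs.2 hA, ⟨a, ha, hR2a⟩, rfl, mem_words.2 hσ, ?_, ?_⟩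
  · rintro rfl
    refine hLT ⟨a, ha, fun c hc => ?_⟩
    rw [hsplit, hσ'] at hc
    exact hR2a c hc
  · rw [insertRight]
    exact Prod.ext rfl (by dsimp only; rw [← hσ', ← hsplit])

/-- Avoidance of `3142` with the largest entry as `4` forces the entries of the left part above
`R` to come last. -/
theorem exists_insertLeft_eq {Y : List ℕ × List ℕ} (h : Y ∈ pairs n) (hs : SepWord (wordOf Y))
    (h0 : Y.2 ≠ []) :
    ∃ i j P σ, i + j = n ∧ P ∈ pairs i ∧ ¬ LeftTop P ∧ P.2 = Y.2 ∧ σ ∈ words j ∧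
      insertLeft P σ = Y := by
  obtain ⟨L', R⟩ := Y
  obtain ⟨a, ha, hmax⟩ := exists_max_of_ne_nil h0
  rw [wordOf_eq h] at hs
  have hsplit : L' = L'.filter (fun b => ¬ ∀ c ∈ R, c < b) ++
      L'.filter (fun b => ∀ c ∈ R, c < b) := by
    have := eq_filter_append_filter (P := fun b => ¬ ∀ c ∈ R, c < b) (l := L')
      fun b c hbc hc => ?_
    · simpa only [not_not] using this
    · intro hb
      push Not at hc
      obtain ⟨c', hc', hcc'⟩ := hc
      have h1 : c ≤ a := hcc'.trans (hmax c' hc')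
      have h2 : c ≠ a := ne_of_mem_pairs h (hbc.subset (by simp)) ha
      have h3 := hb a ha
      have h4 : b < n := lt_of_mem_left h b (hbc.subset (by simp))
      -- `b c n a` is an occurrence of `3142`.
      refine hs b c n a ?_ (.inr ⟨by omega, h3, h4⟩)
      exact hbc.append (List.cons_sublist_cons.2 (List.singleton_sublist.2 ha))
  set L1 := L'.filter (fun b => ¬ ∀ c ∈ R, c < b) with hL1
  set L2 := L'.filter (fun b => ∀ c ∈ R, c < b) with hL2
  have hL2R : ∀ b ∈ L2, ∀ c ∈ R, c < b := fun b hb => by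
    simpa using (List.mem_filter.1 hb).2
  have hL1a : ∀ b ∈ L1, b < a := fun b hb => by
    obtain ⟨hbL, hb⟩ := List.mem_filter.1 hb
    simp only [not_forall, not_lt, decide_eq_true_eq] at hb
    obtain ⟨c, hc, hbc⟩ := hb
    have h1 := hmax c hc
    have h2 := ne_of_mem_pairs h hbL ha
    omega
  have hperm : ((L1 ++ R) ++ L2).Perm (List.range n) := by
    refine List.Perm.trans ?_ (mem_pairs.1 h)
    dsimp only
    conv_rhs => rw [hsplit]
    rw [List.append_assoc, List.append_assoc]
    exact List.perm_append_comm.append_left L1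
  obtain ⟨hA, σ, hσ, hσ'⟩ := perm_range_split hperm fun x hx c hc => by
    rcases List.mem_append.1 hx with hx | hx
    · exact (hL1a x hx).trans (hL2R c hc a ha)
    · exact hL2R c hc x hx
  rw [List.length_append] at hσ'
  refine ⟨(L1 ++ R).length, L2.length, (L1, R), σ,
    List.length_append.symm.trans (hperm.length_eq.trans List.length_range),
    mem_pairs.2 hA, ?_, rfl, mem_words.2 hσ, ?_⟩
  · rintro ⟨b, hb, hc⟩
    have h1 := hc a ha
    have h2 := hL1a b hb
    omega
  · rw [insertLeft]
    exact Prod.ext (by dsimp only; rw [← hσ', ← hsplit]) rfl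

end

/-! ### The two recurrences -/

/-- The part of `geng k i` that comes from the permutations in which the largest entry is not the
last one. -/
noncomputable def gengInner (k i : ℕ) : Series :=
  x * gf (pairClass fun P => (P.1.length = i ∧ AvSep k (wordOf P) ∧ LeftTop P) ∧ ¬ P.2 = []) pairWt

section
variable {k i : ℕ}

theorem ne_nil_of_length {L : List ℕ} (hi : 1 ≤ i) (h : L.length = i) : L ≠ [] := by
  rintro rfl
  simp at h
  omega

/-- Permutations that end with their largest entry. -/
theorem gf_max_last (hi : 1 ≤ i) (hik : i + 1 < k) (b : Poly) (a : Fin 6 → Poly) :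
    gf (pairClass fun P => (P.1.length = i ∧ AvSep k (wordOf P) ∧ LeftTop P) ∧ P.2 = [])
      (fun P => b * wt a P.1) = c b * (c (polyAt a (X i)) * x ^ i) := by
  rw [gf_const_mul, ← gf_sep_length]
  congr 1
  ext1 n
  simp only [gf, PowerSeries.coeff_mk]
  refine Finset.sum_nbij Prod.fst ?_ ?_ ?_ fun _ _ => rfl
  · rintro ⟨L, R⟩ hP
    rw [mem_pairClass] at hP
    obtain ⟨hP, ⟨h1, h2, -⟩, h3⟩ := hP
    dsimp only at h1 h3
    subst h3
    rw [mem_wordClass]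
    refine ⟨mem_words.2 (by simpa using mem_pairs.1 hP), h2.1.sublist ?_, h1⟩
    exact List.sublist_append_left _ _
  · rintro ⟨L, R⟩ hP ⟨L', R'⟩ hP' he
    rw [Finset.mem_coe, mem_pairClass] at hP hP'
    exact Prod.ext he (hP.2.2.trans hP'.2.2.symm)
  · intro l hl
    rw [Finset.mem_coe, mem_wordClass] at hl
    obtain ⟨hl, hs, hi'⟩ := hl
    have hP : (l, []) ∈ pairs n := mem_pairs.2 (by simpa using mem_words.1 hl)
    refine ⟨(l, []), ?_, rfl⟩
    rw [Finset.mem_coe, mem_pairClass]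
    refine ⟨hP, ⟨hi', ?_, ?_⟩, rfl⟩
    · rw [wordOf_eq hP]
      have h1 := lt_of_mem_left hP
      exact ⟨(sepWord_append_max h1).2 hs, (avoidFrom_word_iff h1 (by simp)).2
        ⟨avoidFrom_of_length_lt (by omega), by omega, trivial⟩⟩
    · obtain ⟨b, hb⟩ := List.exists_mem_of_ne_nil l (ne_nil_of_length hi hi')
      exact ⟨b, hb, by simp⟩

theorem geng_eq_add (hi : 1 ≤ i) (hik : i + 1 < k) :
    geng k i = gengInner k i +
      c (p * u * v * t) * x ^ (i + 1) * c (polyAt ![p, q, u, 1, s, t] (X i)) := by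
  rw [geng_eq (by omega), gf_pairClass_split _ fun P => P.2 = [], gengInner]
  rw [gf_congr (fun _ => rfl) (w' := fun P => (p * u * v * t) * wt ![p, q, u, 1, s, t] P.1),
    gf_max_last hi hik]
  · ring
  · rintro n ⟨L, R⟩ hP
    rw [mem_pairClass] at hP
    obtain ⟨hP, ⟨h1, -⟩, h3⟩ := hP
    dsimp only at h1 h3
    subst h3
    rw [pairWt, wordOf_eq hP]
    exact wt_max_last (lt_of_mem_left hP) (ne_nil_of_length hi h1)

/-- Removing the block of top values that follows the largest entry. -/
theorem gf_insertRight (hi : 1 ≤ i) {D : List ℕ × List ℕ → Prop}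
    (hD : ∀ m, ∀ P ∈ pairs m, ∀ σ, D (insertRight P σ) ↔ D P)
    {w : List ℕ × List ℕ → Poly} {w' : List ℕ → Poly}
    (hw : ∀ m j L R σ, (L, R) ∈ pairs m → σ ∈ words j → LeftTop (L, R) → L ≠ [] → σ ≠ [] →
      D (L, R) → pairWt (insertRight (L, R) σ) = w (L, R) * w' σ) :
    gf (pairClass fun P => (P.1.length = i ∧ AvSep k (wordOf P) ∧ ¬ LeftTop P) ∧ D P) pairWt =
      gf (pairClass fun P => (P.1.length = i ∧ AvSep k (wordOf P) ∧ LeftTop P) ∧ D P) w *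
        gf (wordClass fun l => l ≠ [] ∧ AvSep (k - i) l) w' := by
  refine gf_eq_mul insertRight ?_ ?_ ?_ ?_
  · rintro m j ⟨L, R⟩ hP σ hσ
    rw [mem_pairClass] at hP ⊢
    rw [mem_wordClass] at hσ
    obtain ⟨hP, ⟨rfl, h1, -⟩, h2⟩ := hP
    exact ⟨insertRight_mem_pairs hP hσ.1, ⟨rfl, (avSep_insertRight hP hσ.1).2 ⟨hσ.2.2, h1⟩,
      not_leftTop_insertRight hP hσ.2.1⟩, (hD m _ hP σ).2 h2⟩
  · rintro m j m' j' ⟨L, R⟩ hP σ hσ ⟨L', R'⟩ hP' σ' hσ' he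
    rw [mem_pairClass] at hP hP'
    rw [mem_wordClass] at hσ hσ'
    obtain ⟨rfl, h1, rfl⟩ := insertRight_injective hP.1 hP'.1 hP.2.1.2.2 hP'.2.1.2.2 he
    refine ⟨rfl, ?_, h1, rfl⟩
    simpa using (mem_words.1 hσ.1).length_eq.symm.trans (mem_words.1 hσ'.1).length_eq
  · rintro n Y hY
    rw [mem_pairClass] at hY
    obtain ⟨hY, ⟨h1, h2, h3⟩, h4⟩ := hY
    obtain ⟨m, j, ⟨L, R⟩, σ, rfl, hP, hLT, hL, hσ, hσ0, rfl⟩ :=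
      exists_insertRight_eq hY h2.1 (ne_nil_of_length hi h1) h3
    have h5 := (avSep_insertRight hP hσ).1 h2
    have h6 : L.length = i := h1
    rw [h6] at h5
    refine ⟨m, j, (L, R), σ, rfl, ?_, ?_, rfl⟩
    · rw [mem_pairClass]
      exact ⟨hP, ⟨h6, h5.2, hLT⟩, (hD m _ hP σ).1 h4⟩
    · rw [mem_wordClass]
      exact ⟨hσ, hσ0, h5.1⟩
  · rintro m j ⟨L, R⟩ hP σ hσ
    rw [mem_pairClass] at hP
    rw [mem_wordClass] at hσ
    exact hw m j L R σ hP.1 hσ.1 hP.2.1.2.2 (ne_nil_of_length hi hP.2.1.1) hσ.2.1 hP.2.2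

/-- Removing the block of top values, of length `j`, that precedes the largest entry. -/
theorem gf_insertLeft {j : ℕ} (hj : 1 ≤ j) (hji : j ≤ i) (hik : i + 1 < k)
    {w : List ℕ × List ℕ → Poly} {w' : List ℕ → Poly}
    (hw : ∀ m j' L R σ, (L, R) ∈ pairs m → σ ∈ words j' → L.length = i - j → R ≠ [] → σ ≠ [] →
      pairWt (insertLeft (L, R) σ) = w (L, R) * w' σ) :
    gf (pairClass fun P => ((P.1.length = i ∧ AvSep k (wordOf P) ∧ LeftTop P) ∧ ¬ P.2 = []) ∧
        topCount P = j) pairWt =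
      gf (pairClass fun P => (P.1.length = i - j ∧ AvSep k (wordOf P) ∧ ¬ LeftTop P) ∧ ¬ P.2 = [])
          w *
        gf (wordClass fun l => SepWord l ∧ l.length = j) w' := by
  refine gf_eq_mul insertLeft ?_ ?_ ?_ ?_
  · rintro m j' ⟨L, R⟩ hP σ hσ
    rw [mem_pairClass] at hP ⊢
    rw [mem_wordClass] at hσ
    obtain ⟨hP, ⟨h1, h2, h3⟩, h4⟩ := hP
    obtain ⟨hσ, h5, h6⟩ := hσ
    dsimp only at h1
    refine ⟨insertLeft_mem_pairs hP hσ, ⟨⟨?_, ?_, ?_⟩, h4⟩, ?_⟩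
    · rw [insertLeft, List.length_append, List.length_map]
      dsimp only
      omega
    · exact (avSep_insertLeft hP hσ (by omega)).2 ⟨h5, h2⟩
    · exact leftTop_insertLeft hP (ne_nil_of_length hj h6)
    · rw [topCount_insertLeft hP h3, h6]
  · rintro m j m' j' ⟨L, R⟩ hP σ hσ ⟨L', R'⟩ hP' σ' hσ' he
    rw [mem_pairClass] at hP hP'
    rw [mem_wordClass] at hσ hσ'
    obtain ⟨rfl, h1, rfl⟩ := insertLeft_injective hP.1 hP'.1 hP.2.1.2.2 hP'.2.1.2.2 he
    refine ⟨rfl, ?_, h1, rfl⟩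
    simpa using (mem_words.1 hσ.1).length_eq.symm.trans (mem_words.1 hσ'.1).length_eq
  · rintro n Y hY
    rw [mem_pairClass] at hY
    obtain ⟨hY, ⟨⟨h1, h2, h3⟩, h4⟩, h5⟩ := hY
    obtain ⟨m, j', ⟨L, R⟩, σ, rfl, hP, hLT, hR, hσ, rfl⟩ := exists_insertLeft_eq hY h2.1 h4
    rw [topCount_insertLeft hP hLT] at h5
    rw [insertLeft, List.length_append, List.length_map] at h1
    dsimp only at h1
    have h6 := (avSep_insertLeft hP hσ (by omega)).1 h2
    refine ⟨m, j', (L, R), σ, rfl, ?_, ?_, rfl⟩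
    · rw [mem_pairClass]
      refine ⟨hP, ⟨?_, h6.2, hLT⟩, h4⟩
      dsimp only
      omega
    · rw [mem_wordClass]
      exact ⟨hσ, h6.1, h5⟩
  · rintro m j' ⟨L, R⟩ hP σ hσ
    rw [mem_pairClass] at hP
    rw [mem_wordClass] at hσ
    exact hw m j' L R σ hP.1 hσ.1 hP.2.1.1 hP.2.2 (ne_nil_of_length hj hσ.2.2)

theorem exists_lt_insertRight_iff {m : ℕ} {P : List ℕ × List ℕ} (h : P ∈ pairs m) (σ : List ℕ) :
    (∃ c ∈ (insertRight P σ).2, ∃ b ∈ (insertRight P σ).1, c < b) ↔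
      ∃ c ∈ P.2, ∃ b ∈ P.1, c < b := by
  obtain ⟨L, R⟩ := P
  rw [insertRight, length_of_mem_pairs h]
  constructor
  · rintro ⟨c, hc, b, hb, hcb⟩
    rcases List.mem_append.1 hc with hc | hc
    · obtain ⟨d, -, rfl⟩ := List.mem_map.1 hc
      have := lt_of_mem_left h b hb
      omega
    · exact ⟨c, hc, b, hb, hcb⟩
  · rintro ⟨c, hc, b, hb, hcb⟩
    exact ⟨c, List.mem_append_right _ hc, b, hb, hcb⟩

theorem exists_lt_iff_of_leftTop {P : List ℕ × List ℕ} (h : LeftTop P) :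
    (∃ c ∈ P.2, ∃ b ∈ P.1, c < b) ↔ ¬ P.2 = [] := by
  constructor
  · rintro ⟨c, hc, -⟩
    exact List.ne_nil_of_mem hc
  · intro h0
    obtain ⟨c, hc⟩ := List.exists_mem_of_ne_nil _ h0
    obtain ⟨b, hb, hR⟩ := h
    exact ⟨c, hc, b, hb, hR c hc⟩

theorem block_bounds {m j : ℕ} {σ : List ℕ} (hσ : σ ∈ words j) :
    (∀ a ∈ σ.map (· + m), m ≤ a) ∧ ∀ a ∈ σ.map (· + m), a < m + j := by
  constructor
  · simp
  · intro a ha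
    obtain ⟨b, hb, rfl⟩ := List.mem_map.1 ha
    have := lt_of_mem_words hσ b hb
    omega

/-- If the second largest entry stands to the right of the largest, removing the block of top
values after the largest entry leaves a permutation in which it stands to the left. -/
theorem genf_eq_add (hi : 1 ≤ i) (hik : i + 1 < k) :
    genf k i =
      c (p * q * u * v) * x ^ (i + 1) * c (polyAt ![p, q, u, 1, s, t] (X i))
          * (serAt ![p, q, 1, v, 1, t] (genF (k - i)) - 1)
      + c q * (serAt ![p, q, 1, v, 1, 1] (genF (k - i)) - 1) * gengInner k i := by
  -- The condition that separates the two weight formulas, that the right part is empty once the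
  -- block is removed, is expressed so that it can be read off before and after the removal.
  rw [genf_eq (by omega), gf_pairClass_split _ fun P => ∃ c ∈ P.2, ∃ b ∈ P.1, c < b]
  rw [gf_insertRight (w := pairWt) (w' := fun σ => q * wt ![p, q, 1, v, 1, 1] σ) hi
      fun m P hP σ => exists_lt_insertRight_iff hP σ,
    gf_insertRight (w := fun P => (p * q * u * v) * wt ![p, q, u, 1, s, t] P.1)
      (w' := wt ![p, q, 1, v, 1, t]) hi
      fun m P hP σ => not_congr (exists_lt_insertRight_iff hP σ)]
  · have h1 : ∀ n, pairClass (fun P => (P.1.length = i ∧ AvSep k (wordOf P) ∧ LeftTop P) ∧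
        ∃ c ∈ P.2, ∃ b ∈ P.1, c < b) n = pairClass (fun P =>
        (P.1.length = i ∧ AvSep k (wordOf P) ∧ LeftTop P) ∧ ¬ P.2 = []) n := fun n => by
      ext P
      rw [mem_pairClass, mem_pairClass]
      exact and_congr_right fun _ => and_congr_right fun h => exists_lt_iff_of_leftTop h.2.2
    have h2 : ∀ n, pairClass (fun P => (P.1.length = i ∧ AvSep k (wordOf P) ∧ LeftTop P) ∧
        ¬ ∃ c ∈ P.2, ∃ b ∈ P.1, c < b) n = pairClass (fun P =>
        (P.1.length = i ∧ AvSep k (wordOf P) ∧ LeftTop P) ∧ P.2 = []) n := fun n => by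
      ext P
      rw [mem_pairClass, mem_pairClass]
      exact and_congr_right fun _ => and_congr_right fun h =>
        (not_congr (exists_lt_iff_of_leftTop h.2.2)).trans not_not
    rw [gf_congr h1 fun _ _ _ => rfl, gf_congr h2 fun _ _ _ => rfl, gf_max_last hi hik,
      gf_const_mul, ← serAt_genF_sub_one (by omega), ← serAt_genF_sub_one (by omega), gengInner]
    ring
  · intro m j L R σ h hσ hLT hL hσ0 hD
    rw [exists_lt_iff_of_leftTop hLT, not_not] at hD
    dsimp only at hD
    subst hD
    have hm : L.length = m := by simpa using length_of_mem_pairs h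
    obtain ⟨hb1, hb2⟩ := block_bounds (m := m) hσ
    rw [pairWt, wordOf_insertRight h hσ, List.append_nil, wt_left_below _ hb2 _ hL (by simpa),
      wt_map_add]
    · exact fun a ha => (lt_of_mem_left h a ha).trans_le (by omega)
    · exact fun a ha b hb => (lt_of_mem_left h a ha).trans_le (hb1 b hb)
  · intro m j L R σ h hσ hLT hL hσ0 hD
    rw [exists_lt_iff_of_leftTop hLT] at hD
    obtain ⟨hb1, hb2⟩ := block_bounds (m := m) hσ
    rw [pairWt, pairWt, wordOf_insertRight h hσ, wordOf_eq h,
      wt_insert_right (lt_of_mem_left h) (lt_of_mem_right h) hb1 hb2 (by omega) hL hD (by simpa),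
      wt_map_add]
    ring

/-- Permutations that begin with their largest entry, weighted by the remaining entries. -/
theorem gf_max_first (hk : 2 ≤ k) (a : Fin 6 → Poly) :
    gf (pairClass fun P => (P.1.length = 0 ∧ AvSep k (wordOf P) ∧ ¬ LeftTop P) ∧ ¬ P.2 = [])
      (fun P => wt a P.2) = serAt a (genF k) - 1 := by
  rw [serAt_genF_sub_one (by omega)]
  ext1 n
  simp only [gf, PowerSeries.coeff_mk]
  have hav : ∀ R, ([], R) ∈ pairs n → (AvSep k (wordOf ([], R)) ↔ AvSep k R) := fun R hP => by
    have h1 := lt_of_mem_right hP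
    rw [wordOf_eq hP]
    refine and_congr (sepWord_cons_max h1) ?_
    rw [avoidFrom_word_iff (by simp) h1]
    simp only [AvoidFrom, List.length_nil]
    exact ⟨fun h => h.2.2, fun h => ⟨trivial, by omega, h⟩⟩
  refine Finset.sum_nbij Prod.snd ?_ ?_ ?_ fun _ _ => rfl
  · rintro ⟨L, R⟩ hP
    rw [mem_pairClass] at hP
    obtain ⟨hP, ⟨h1, h2, -⟩, h3⟩ := hP
    obtain rfl := List.length_eq_zero_iff.1 h1
    rw [mem_wordClass]
    exact ⟨mem_words.2 (mem_pairs.1 hP), h3, (hav R hP).1 h2⟩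
  · rintro ⟨L, R⟩ hP ⟨L', R'⟩ hP' he
    rw [Finset.mem_coe, mem_pairClass] at hP hP'
    exact Prod.ext ((List.length_eq_zero_iff.1 hP.2.1.1).trans
      (List.length_eq_zero_iff.1 hP'.2.1.1).symm) he
  · intro l hl
    rw [Finset.mem_coe, mem_wordClass] at hl
    obtain ⟨hl, h0, hs⟩ := hl
    have hP : ([], l) ∈ pairs n := mem_pairs.2 (mem_words.1 hl)
    refine ⟨([], l), ?_, rfl⟩
    rw [Finset.mem_coe, mem_pairClass]
    refine ⟨hP, ⟨rfl, (hav l hP).2 hs, ?_⟩, h0⟩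
    rintro ⟨b, hb, -⟩
    simp at hb

theorem genf_zero (hk : 2 ≤ k) :
    genf k 0 = c (u * v * s * t) * x +
      c (q * u * v * s) * x * (serAt ![p, q, 1, v, s, t] (genF k) - 1) := by
  rw [genf_eq (by omega), gf_pairClass_split _ fun P => P.2 = [], ← gf_max_first hk]
  have h1 : gf (pairClass fun P => (P.1.length = 0 ∧ AvSep k (wordOf P) ∧ ¬ LeftTop P) ∧ P.2 = [])
      pairWt = c (u * v * s * t) := by
    ext1 n
    rw [c, PowerSeries.coeff_C]
    simp only [gf, PowerSeries.coeff_mk]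
    split_ifs with hn
    · subst hn
      have h2 : pairClass (fun P => (P.1.length = 0 ∧ AvSep k (wordOf P) ∧ ¬ LeftTop P) ∧
          P.2 = []) 0 = {([], [])} := by
        ext ⟨L, R⟩
        rw [mem_pairClass, Finset.mem_singleton]
        constructor
        · rintro ⟨-, ⟨h2, -⟩, h3⟩
          exact Prod.ext (List.length_eq_zero_iff.1 h2) h3
        · rintro h
          rw [h]
          exact ⟨mem_pairs.2 (by simp), ⟨rfl,
            ⟨sepWord_singleton 0, by simp [wordOf, AvoidFrom]; omega⟩, by simp [LeftTop]⟩, rfl⟩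
      rw [h2, Finset.sum_singleton, pairWt, wordOf]
      simpa using wt_single ![p, q, u, v, s, t] 0
    · refine Finset.sum_eq_zero ?_
      rintro ⟨L, R⟩ hP
      rw [mem_pairClass] at hP
      obtain ⟨hP, ⟨h2, -⟩, h3⟩ := hP
      have := length_of_mem_pairs hP
      dsimp only at h2 h3
      subst h3
      simp at this
      omega
  rw [h1, gf_congr (fun _ => rfl) (w' := fun P => (q * u * v * s) * wt ![p, q, 1, v, s, t] P.2),
    gf_const_mul]
  · ring
  · rintro n ⟨L, R⟩ hP
    rw [mem_pairClass] at hP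
    obtain ⟨hP, ⟨h2, -⟩, h3⟩ := hP
    obtain rfl := List.length_eq_zero_iff.1 h2
    rw [pairWt, wordOf_eq hP]
    exact wt_max_first (lt_of_mem_right hP) h3

theorem geng_zero (hk : 1 ≤ k) : geng k 0 = 0 := by
  rw [geng_eq hk]
  have : gf (pairClass fun P => P.1.length = 0 ∧ AvSep k (wordOf P) ∧ LeftTop P) pairWt = 0 := by
    ext1 n
    simp only [gf, PowerSeries.coeff_mk, map_zero]
    refine Finset.sum_eq_zero ?_
    rintro ⟨L, R⟩ hP
    rw [mem_pairClass] at hP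
    obtain ⟨-, h1, -, b, hb, -⟩ := hP
    obtain rfl := List.length_eq_zero_iff.1 h1
    simp at hb
  rw [this, mul_zero]

/-- If the second largest entry stands to the left of the largest, removing the block of top
values before the largest entry leaves a permutation in which it stands to the right. -/
theorem gengInner_eq (hi : 1 ≤ i) (hik : i + 1 < k) :
    gengInner k i =
      c (p * q * u * v) * x ^ (i + 1) * c (polyAt ![p, q, u, 1, s, 1] (X i))
          * (serAt ![p, q, 1, v, s, t] (genF k) - 1)
      + c p * ∑ j ∈ Finset.Icc 1 (i - 1),
          c (polyAt ![p, q, u, 1, 1, 1] (X j)) * x ^ j * genf k (i - j) := by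
  have hIcc : Finset.Icc 1 i = insert i (Finset.Icc 1 (i - 1)) := by
    ext j
    simp only [Finset.mem_Icc, Finset.mem_insert]
    omega
  -- For `j = i` the block is the whole left part, and the remaining permutation begins with its
  -- largest entry; this term has its own weight formula.
  rw [gengInner, gf_pairClass_fiber _ _ topCount (Finset.Icc 1 i), hIcc,
    Finset.sum_insert (by simp; omega), mul_add]
  · congr 1
    · rw [gf_insertLeft (w := fun P => wt ![p, q, 1, v, s, t] P.2)
        (w' := fun σ => (p * q * u * v) * wt ![p, q, u, 1, s, 1] σ) hi le_rfl hik, Nat.sub_self,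
        gf_max_first (by omega), gf_const_mul, gf_sep_length]
      · ring
      · intro m j' L R σ h hσ hL hR hσ0
        obtain rfl := List.length_eq_zero_iff.1 (hL.trans (Nat.sub_self i))
        obtain ⟨hb1, hb2⟩ := block_bounds (m := m) hσ
        rw [pairWt, wordOf_insertLeft h hσ, List.nil_append,
          wt_left_above hb2 _ _ hR (by simpa), wt_map_add]
        · ring
        · exact fun a ha => (lt_of_mem_right h a ha).trans_le (by omega)
        · exact fun a ha b hb => (lt_of_mem_right h a ha).trans_le (hb1 b hb)
    · rw [Finset.mul_sum, Finset.mul_sum]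
      refine Finset.sum_congr rfl fun j hj => ?_
      rw [Finset.mem_Icc] at hj
      rw [gf_insertLeft (w := pairWt) (w' := fun σ => p * wt ![p, q, u, 1, 1, 1] σ) hj.1
        (by omega) hik, gf_const_mul, gf_sep_length, genf_eq (by omega)]
      · have h1 : ∀ n, pairClass (fun P => (P.1.length = i - j ∧ AvSep k (wordOf P) ∧
            ¬ LeftTop P) ∧ ¬ P.2 = []) n = pairClass (fun P =>
            P.1.length = i - j ∧ AvSep k (wordOf P) ∧ ¬ LeftTop P) n := fun n => by
          ext ⟨L, R⟩
          rw [mem_pairClass, mem_pairClass]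
          refine and_congr_right fun _ => and_iff_left_of_imp fun h h0 => h.2.2 ?_
          obtain ⟨b, hb⟩ := List.exists_mem_of_ne_nil L (ne_nil_of_length (by omega) h.1)
          dsimp only at h0
          subst h0
          exact ⟨b, hb, by simp⟩
        rw [gf_congr h1 fun _ _ _ => rfl]
        ring
      · intro m j' L R σ h hσ hL hR hσ0
        obtain ⟨hb1, hb2⟩ := block_bounds (m := m) hσ
        rw [pairWt, pairWt, wordOf_insertLeft h hσ, wordOf_eq h,
          wt_insert_left (lt_of_mem_left h) (lt_of_mem_right h) hb1 hb2 (by omega)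
            (ne_nil_of_length (by omega) hL) hR (by simpa), wt_map_add]
        ring
  · rintro n ⟨L, R⟩ h ⟨⟨h1, h2, b, hb, hR⟩, h4⟩
    rw [Finset.mem_Icc]
    constructor
    · exact List.length_pos_of_mem (List.mem_filter.2 ⟨hb, by simpa using hR⟩)
    · rw [← h1]
      exact List.length_filter_le _ _

end

/-! ### The generating functions solve the system -/

theorem genF_eq_one_add_sum {k : ℕ} (hk : 1 ≤ k) :
    genF k = 1 + ∑ i ∈ Finset.range (k - 1), (genf k i + geng k i) := by
  rw [genF_eq_one_add hk, gf_pairClass_fiber _ _ (fun P => P.1.length) (Finset.range (k - 1)),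
    Finset.mul_sum]
  · congr 1
    refine Finset.sum_congr rfl fun i _ => ?_
    have h1 : (fun P => (AvSep k (wordOf P) ∧ P.1.length = i) ∧ LeftTop P) =
        fun P => P.1.length = i ∧ AvSep k (wordOf P) ∧ LeftTop P := by
      ext P; tauto
    have h2 : (fun P => (AvSep k (wordOf P) ∧ P.1.length = i) ∧ ¬ LeftTop P) =
        fun P => P.1.length = i ∧ AvSep k (wordOf P) ∧ ¬ LeftTop P := by
      ext P; tauto
    rw [gf_pairClass_split _ LeftTop, genf_eq hk, geng_eq hk, mul_add, add_comm, h1, h2]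
  · rintro n ⟨L, R⟩ h hav
    rw [wordOf_eq h] at hav
    have := ((avoidFrom_word_iff (lt_of_mem_left h) (lt_of_mem_right h)).1 hav.2).2.1
    rw [Finset.mem_range]
    dsimp only
    omega

/-- The equation for `f_{k,i}`: one recurrence substituted into the other. -/
theorem genf_system {k i : ℕ} (hi : 1 ≤ i) (hik : i ≤ k - 2) :
    genf k i =
      c (p * q * u * v) * x ^ (i + 1) * c (polyAt ![p, q, u, 1, s, t] (X i))
          * (serAt ![p, q, 1, v, 1, t] (genF (k - i)) - 1)
      + c (p * q ^ 2 * u * v) * x ^ (i + 1) * c (polyAt ![p, q, u, 1, s, 1] (X i))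
          * (serAt ![p, q, 1, v, 1, 1] (genF (k - i)) - 1)
          * (serAt ![p, q, 1, v, s, t] (genF k) - 1)
      + c (p * q) * (serAt ![p, q, 1, v, 1, 1] (genF (k - i)) - 1)
          * ∑ j ∈ Finset.Icc 1 (i - 1),
              c (polyAt ![p, q, u, 1, 1, 1] (X j)) * x ^ j * genf k (i - j) := by
  rw [genf_eq_add hi (by omega), gengInner_eq hi (by omega)]
  simp only [c, map_mul, map_pow]
  ring

theorem geng_system {k i : ℕ} (hi : 1 ≤ i) (hik : i ≤ k - 2) :
    geng k i =
      c (p * u * v * t) * x ^ (i + 1) * c (polyAt ![p, q, u, 1, s, t] (X i))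
      + c (p * q * u * v) * x ^ (i + 1) * c (polyAt ![p, q, u, 1, s, 1] (X i))
          * (serAt ![p, q, 1, v, s, t] (genF k) - 1)
      + c (p ^ 2 * q * u * v) * x ^ (i + 1)
          * ∑ j ∈ Finset.Icc 1 (i - 1),
              c (polyAt ![p, q, u, 1, 1, 1] (X j))
                * c (polyAt ![p, q, u, 1, s, t] (X (i - j)))
                * (serAt ![p, q, 1, v, 1, t] (genF (k - i + j)) - 1)
      + c (p * q)
          * ∑ j ∈ Finset.Icc 1 (i - 1),
              c (polyAt ![p, q, u, 1, 1, 1] (X j)) * x ^ j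
                * (serAt ![p, q, 1, v, 1, 1] (genF (k - i + j)) - 1)
                * (geng k (i - j)
                    - c (p * u * v * t) * x ^ (i - j + 1)
                      * c (polyAt ![p, q, u, 1, s, t] (X (i - j)))) := by
  rw [geng_eq_add hi (by omega), gengInner_eq hi (by omega)]
  have h : c p * ∑ j ∈ Finset.Icc 1 (i - 1),
        c (polyAt ![p, q, u, 1, 1, 1] (X j)) * x ^ j * genf k (i - j) =
      c (p ^ 2 * q * u * v) * x ^ (i + 1)
          * ∑ j ∈ Finset.Icc 1 (i - 1),
              c (polyAt ![p, q, u, 1, 1, 1] (X j))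
                * c (polyAt ![p, q, u, 1, s, t] (X (i - j)))
                * (serAt ![p, q, 1, v, 1, t] (genF (k - i + j)) - 1)
      + c (p * q)
          * ∑ j ∈ Finset.Icc 1 (i - 1),
              c (polyAt ![p, q, u, 1, 1, 1] (X j)) * x ^ j
                * (serAt ![p, q, 1, v, 1, 1] (genF (k - i + j)) - 1)
                * (geng k (i - j)
                    - c (p * u * v * t) * x ^ (i - j + 1)
                      * c (polyAt ![p, q, u, 1, s, t] (X (i - j)))) := by
    rw [Finset.mul_sum, Finset.mul_sum, Finset.mul_sum, ← Finset.sum_add_distrib]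
    refine Finset.sum_congr rfl fun j hj => ?_
    rw [Finset.mem_Icc] at hj
    have hx : x ^ (i + 1) = x ^ j * x ^ (i - j + 1) := by rw [← pow_add]; congr 1; omega
    rw [genf_eq_add (by omega) (by omega), geng_eq_add (by omega) (by omega), hx,
      show k - (i - j) = k - i + j by omega]
    simp only [c, map_mul, map_pow]
    ring
  rw [h]
  ring

theorem polyAt_idem (a : Poly) :
    polyAt ![p, q, 1, v, s, t] (polyAt ![p, q, 1, v, s, t] a) = polyAt ![p, q, 1, v, s, t] a := by
  have : (polyAt ![p, q, 1, v, s, t]).comp (polyAt ![p, q, 1, v, s, t]) =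
      polyAt ![p, q, 1, v, s, t] := by
    apply MvPolynomial.algHom_ext
    intro i
    fin_cases i <;> simp [polyAt, p, q, v, s, t]
  exact DFunLike.congr_fun this a

theorem serAt_idem (A : Series) :
    serAt ![p, q, 1, v, s, t] (serAt ![p, q, 1, v, s, t] A) = serAt ![p, q, 1, v, s, t] A := by
  ext1 n
  simp only [serAt, PowerSeries.coeff_map]
  exact polyAt_idem _

theorem serAt_c (a : Fin 6 → Poly) (b : Poly) : serAt a (c b) = c (polyAt a b) :=
  PowerSeries.map_C _ _

theorem serAt_x (a : Fin 6 → Poly) : serAt a x = x := PowerSeries.map_X _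

/-- For `k = 2` the system reduces to a linear equation for `F_2(x, p, q, 1, v, s, t)`. -/
theorem genf_two_zero : genf 2 0 * (1 - c (q * v * s) * x) = c (u * v * s * t) * x := by
  have hF := genF_eq_one_add_sum (k := 2) (by norm_num)
  have h0 := genf_zero (k := 2) le_rfl
  simp only [Nat.add_one_sub_one, Finset.sum_range_one, geng_zero (k := 2) (by norm_num),
    add_zero] at hF
  set h := serAt ![p, q, 1, v, s, t] (genF 2) - 1 with hh
  have h1 : h = serAt ![p, q, 1, v, s, t] (genf 2 0) := by
    rw [hh, hF, map_add, map_one]; ring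
  have h2 : serAt ![p, q, 1, v, s, t] h = h := by
    rw [hh, map_sub, serAt_idem, map_one]
  have h3 : h = c (v * s * t) * x + c (q * v * s) * x * h := by
    conv_lhs => rw [h1, h0]
    rw [map_add, map_mul, map_mul, map_mul, h2, serAt_c, serAt_c, serAt_x]
    congr 3 <;> simp [polyAt, p, q, u, v, s, t]
  have h4 : genf 2 0 = c u * h := by
    conv_rhs => rw [h3]
    rw [h0]
    simp only [c, map_mul]
    ring
  have h5 : h * (1 - c (q * v * s) * x) = c (v * s * t) * x := by
    linear_combination h3
  rw [h4, mul_assoc, h5]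
  simp only [c, map_mul]
  ring

theorem isSolution_gen {k : ℕ} (hk : 2 ≤ k) : IsSolution k genF genf geng where
  eq_F := genF_eq_one_add_sum (by omega)
  eq_f _ hi hik := genf_system hi hik
  eq_g _ hi hik := geng_system hi hik
  init_f := genf_zero hk
  init_g := geng_zero (by omega)
  init_f_two h := genf_two_zero

/-! ### Uniqueness of the solution -/

/-- Two power series agree modulo `x ^ n`. -/
def Agree (n : ℕ) (A B : Series) : Prop := x ^ n ∣ A - B

namespace Agree

variable {n : ℕ} {A A' B B' : Series}

theorem refl (n : ℕ) (A : Series) : Agree n A A := by simp [Agree]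

theorem add (h : Agree n A A') (h' : Agree n B B') : Agree n (A + B) (A' + B') := by
  have := dvd_add h h'
  rwa [Agree, add_sub_add_comm]

theorem sub (h : Agree n A A') (h' : Agree n B B') : Agree n (A - B) (A' - B') := by
  have := dvd_sub h h'
  rwa [Agree, sub_sub_sub_comm]

theorem mul_left (h : Agree n A A') (B : Series) : Agree n (B * A) (B * A') := by
  rw [Agree, ← mul_sub]
  exact dvd_mul_of_dvd_right h B

theorem sum {ι : Type*} {I : Finset ι} {a a' : ι → Series} (h : ∀ i ∈ I, Agree n (a i) (a' i)) :
    Agree n (∑ i ∈ I, a i) (∑ i ∈ I, a' i) := by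
  rw [Agree, ← Finset.sum_sub_distrib]
  exact Finset.dvd_sum h

theorem serAt (h : Agree n A A') (a : Fin 6 → Poly) :
    Agree n (serAt a A) (SepPOP.serAt a A') := by
  have := map_dvd (SepPOP.serAt a) h
  rwa [map_pow, serAt_x, map_sub] at this

/-- A factor divisible by `x` improves the precision. -/
theorem succ_mul (h : Agree n A A') (hB : x ∣ B) : Agree (n + 1) (B * A) (B * A') := by
  rw [Agree, ← mul_sub, pow_succ']
  exact mul_dvd_mul hB h

end Agree

theorem eq_of_forall_agree {A B : Series} (h : ∀ n, Agree n A B) : A = B := by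
  rw [← sub_eq_zero]
  ext1 n
  exact PowerSeries.X_pow_dvd_iff.1 (h (n + 1)) n n.lt_succ_self

section
variable {k : ℕ} {F F' : ℕ → Series} {f f' g g' : ℕ → ℕ → Series}

theorem agree_f (h : IsSolution k F f g) (h' : IsSolution k F' f' g')
    (hlow : ∀ m, 2 ≤ m → m < k → F m = F' m) {n : ℕ} (hF : Agree n (F k) (F' k)) {i : ℕ}
    (hi : i ≤ k - 2) : Agree (n + 1) (f k i) (f' k i) := by
  have hF1 := (hF.serAt ![p, q, 1, v, s, t]).sub (Agree.refl n 1)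
  induction i using Nat.strong_induction_on with
  | _ i ih =>
    rcases Nat.eq_zero_or_pos i with rfl | h1
    · rw [h.init_f, h'.init_f]
      exact (Agree.refl _ _).add (hF1.succ_mul (dvd_mul_left _ _))
    · rw [h.eq_f i h1 hi, h'.eq_f i h1 hi, hlow (k - i) (by omega) (by omega)]
      refine ((Agree.refl _ _).add (hF1.succ_mul ?_)).add (Agree.mul_left (Agree.sum ?_) _)
      · exact (((dvd_pow_self x (by omega)).mul_left _).mul_right _).mul_right _
      · intro j hj
        rw [Finset.mem_Icc] at hj
        exact (ih (i - j) (by omega) (by omega)).mul_left _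

theorem agree_g (h : IsSolution k F f g) (h' : IsSolution k F' f' g')
    (hlow : ∀ m, 2 ≤ m → m < k → F m = F' m) {n : ℕ} (hF : Agree n (F k) (F' k)) {i : ℕ}
    (hi : i ≤ k - 2) : Agree (n + 1) (g k i) (g' k i) := by
  have hF1 := (hF.serAt ![p, q, 1, v, s, t]).sub (Agree.refl n 1)
  induction i using Nat.strong_induction_on with
  | _ i ih =>
    rcases Nat.eq_zero_or_pos i with rfl | h1
    · rw [h.init_g, h'.init_g]
      exact Agree.refl _ _
    · rw [h.eq_g i h1 hi, h'.eq_g i h1 hi]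
      refine (((Agree.refl _ _).add (hF1.succ_mul ?_)).add (Agree.mul_left (Agree.sum ?_) _)).add
        (Agree.mul_left (Agree.sum ?_) _)
      · exact ((dvd_pow_self x (by omega)).mul_left _).mul_right _
      · intro j hj
        rw [Finset.mem_Icc] at hj
        rw [hlow (k - i + j) (by omega) (by omega)]
        exact Agree.refl _ _
      · intro j hj
        rw [Finset.mem_Icc] at hj
        rw [hlow (k - i + j) (by omega) (by omega)]
        exact ((ih (i - j) (by omega) (by omega)).sub (Agree.refl _ _)).mul_left _

/-- Every occurrence of `F k` on the right-hand sides carries a factor `x`, so each pass through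
the system gains one coefficient. -/
theorem agree_F (hk : 2 ≤ k) (h : IsSolution k F f g) (h' : IsSolution k F' f' g')
    (hlow : ∀ m, 2 ≤ m → m < k → F m = F' m) (n : ℕ) : Agree n (F k) (F' k) := by
  induction n with
  | zero => simp [Agree]
  | succ n ih =>
    rw [h.eq_F, h'.eq_F]
    refine (Agree.refl _ _).add (Agree.sum fun i hi => ?_)
    rw [Finset.mem_range] at hi
    exact (agree_f h h' hlow ih (by omega)).add (agree_g h h' hlow ih (by omega))

end

theorem eq_gen_of_isSolution {k : ℕ} {F : ℕ → Series} {f g : ℕ → ℕ → Series}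
    (h : ∀ m, 2 ≤ m → m ≤ k → IsSolution m F f g) :
    ∀ m, 2 ≤ m → m ≤ k → F m = genF m := by
  intro m
  induction m using Nat.strong_induction_on with
  | _ m ih =>
    intro h2 hmk
    exact eq_of_forall_agree (agree_F h2 (h m h2 hmk) (isSolution_gen h2)
      fun m' h2' hm' => ih m' hm' h2' (by omega))

end SepPOP

theorem theorem3 (k : ℕ) (hk : 2 ≤ k) :
    SepPOP.IsSolution k SepPOP.genF SepPOP.genf SepPOP.geng ∧
    ∀ (F : ℕ → SepPOP.Series) (f g : ℕ → ℕ → SepPOP.Series),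
      (∀ m, 2 ≤ m → m ≤ k → SepPOP.IsSolution m F f g) →
      F k = SepPOP.genF k ∧
      ∀ i, i ≤ k - 2 → f k i = SepPOP.genf k i ∧ g k i = SepPOP.geng k i := by
  refine ⟨SepPOP.isSolution_gen hk, fun F f g h => ?_⟩
  have hF := SepPOP.eq_gen_of_isSolution h
  have hlow : ∀ m, 2 ≤ m → m < k → F m = SepPOP.genF m := fun m h2 hm => hF m h2 hm.le
  have hk' := h k hk le_rfl
  have hg := SepPOP.isSolution_gen hk
  refine ⟨hF k hk le_rfl, fun i hi => ⟨?_, ?_⟩⟩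
  · exact SepPOP.eq_of_forall_agree fun n => (pow_dvd_pow _ n.le_succ).trans
      (SepPOP.agree_f hk' hg hlow (SepPOP.agree_F hk hk' hg hlow n) hi)
  · exact SepPOP.eq_of_forall_agree fun n => (pow_dvd_pow _ n.le_succ).trans
      (SepPOP.agree_g hk' hg hlow (SepPOP.agree_F hk hk' hg hlow n) hi)
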